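/- Let $n\ge 1$, $0<\alpha<n$, $0\le\lambda\le n$ and $\beta\in(0,1)$. Let $\Phi:[0,\infty)\to[0,\infty]$ be a Young function (convex, left-continuous, $\lim_{r\to0+}\Phi(r)=\Phi(0)=0$, $\lim_{r\to\infty}\Phi(r)=\infty$) such that $\Phi\in\Delta'$, i.e. for some $C>1$, $\Phi(tr)\le C\,\Phi(t)\Phi(r)$ for all $t,r\ge0$, and $\Phi\in\nabla_2$, i.e. for some $C>1$, $\Phi(r)\le\frac1{2C}\Phi(Cr)$ for all $r\ge0$. Put $\Psi(t)=\Phi(t^{1/\beta})$ and $\Phi^{-1}(s)=\inf\{r\ge0:\Phi(r)>s\}$. For a Young function $\Theta$ let $$\|f\|_{L^\Theta}=\inf\Big\{c>0:\int_{\mathbb R^n}\Theta\big(|f(x)|/c\big)\,dx\le1\Big\},\qquad \|f\|_{\mathcal M^{\Theta,\lambda}}=\sup_{x\in\mathbb R^n,\,r>0}\Theta^{-1}\big(|B(x,r)|^{-\lambda/n}\big)\,\|f\chi_{B(x,r)}\|_{L^\Theta},$$ and let the Orlicz–Morrey space $\mathcal M^{\Theta,\lambda}(\mathbb R^n)$ consist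 of all $f$ with $\|f\|_{\mathcal M^{\Theta,\lambda}}<\infty$ such that, for every ball $B$, $f\chi_B$ is locally integrable and $\int_{\mathbb R^n}\Theta(k|f\chi_B|)\,dx<\infty$ for some $k>0$. Let $$M_\alpha f(x)=\sup_{t>0}|B(x,t)|^{-1+\frac{\alpha}{n}}\int_{B(x,t)}|f(y)|\,dy .$$ Assume that there is a constant $C>0$ such that, for all $t>0$, $$\sup_{t<r<\infty}r^\alpha\,\frac{\Phi^{-1}(r^{-n})}{\Phi^{-1}(r^{-\lambda})}\le C\,t^\alpha\,\frac{\Phi^{-1}(t^{-n})}{\Phi^{-1}(t^{-\lambda})}.$$ Then the condition that there is a constant $C>0$ with $$t^\alpha\le C\left[\frac{\Phi^{-1}(t^{-n})}{\Phi^{-1}(t^{-\lambda})}\right]^{\beta-1}\quad\text{for all }t>0$$ is necessary and sufficient for the boundedness of $M_\alpha$ from $\mathcal M^{\Phi,\lambda}(\mathbb R^n)$ to $\mathcal M^{\Psi,\lambda}(\mathbb R^n)$, i.e. for the existence of a constant $C$ such that, for every $f\in\mathcal M^{\Phi,\lambda}(\mathbb R^n)$, $M_\alpha f$ is finite almost everywhere,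 belongs to $\mathcal M^{\Psi,\lambda}(\mathbb R^n)$, and $\|M_\alpha f\|_{\mathcal M^{\Psi,\lambda}}\le C\|f\|_{\mathcal M^{\Phi,\lambda}}$. -/

import Mathlib

open Set Filter Topology MeasureTheory
open scoped NNReal ENNReal

namespace OrliczMorrey

/-- Young functions `[0, ∞) → [0, ∞]`. -/
structure IsYoung (Φ : ℝ≥0 → ℝ≥0∞) : Prop where
  convex : ConvexOn ℝ≥0 univ Φ
  leftCts : ∀ r : ℝ≥0, ContinuousWithinAt Φ (Iic r) r
  map_zero : Φ 0 = 0
  tendsto_zero : Tendsto Φ (𝓝[>] 0) (𝓝 0)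
  tendsto_top : Tendsto Φ atTop (𝓝 ∞)

/-- The condition `Δ'`. -/
def DeltaPrime (Φ : ℝ≥0 → ℝ≥0∞) : Prop :=
  ∃ C : ℝ≥0, 1 < C ∧ ∀ t r : ℝ≥0, Φ (t * r) ≤ C * Φ t * Φ r

/-- The condition `∇₂`. -/
def NablaTwo (Φ : ℝ≥0 → ℝ≥0∞) : Prop :=
  ∃ C : ℝ≥0, 1 < C ∧ ∀ r : ℝ≥0, Φ r ≤ 1 / (2 * (C : ℝ≥0∞)) * Φ (C * r)

/-- The generalized inverse `Φ⁻¹(s) = inf {r ≥ 0 : Φ(r) > s}`, for `0 ≤ s ≤ ∞` (with `inf ∅ = ∞`). -/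
noncomputable def youngInv (Φ : ℝ≥0 → ℝ≥0∞) (s : ℝ≥0∞) : ℝ≥0∞ :=
  ⨅ (r : ℝ≥0) (_ : s < Φ r), (r : ℝ≥0∞)

/-- Membership in the Orlicz space `L^Φ(ℝⁿ)`. -/
def MemOrlicz {n : ℕ} (Φ : ℝ≥0 → ℝ≥0∞) (f : EuclideanSpace ℝ (Fin n) → ℝ) : Prop :=
  LocallyIntegrable f volume ∧ ∃ k : ℝ≥0, 0 < k ∧ ∫⁻ x, Φ (k * ‖f x‖₊) < ∞

/-- Membership in `L^Φ_loc(ℝⁿ)`. -/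
def MemOrliczLoc {n : ℕ} (Φ : ℝ≥0 → ℝ≥0∞) (f : EuclideanSpace ℝ (Fin n) → ℝ) : Prop :=
  ∀ (x : EuclideanSpace ℝ (Fin n)) (r : ℝ), 0 < r →
    MemOrlicz Φ ((Metric.ball x r).indicator f)

/-- The Luxemburg norm of `L^Φ(ℝⁿ)` (equal to `∞` when no admissible constant exists). -/
noncomputable def orliczNorm {n : ℕ} (Φ : ℝ≥0 → ℝ≥0∞)
    (f : EuclideanSpace ℝ (Fin n) → ℝ) : ℝ≥0∞ :=
  ⨅ (c : ℝ≥0) (_ : 0 < c ∧ ∫⁻ x, Φ (‖f x‖₊ / c) ≤ 1), (c : ℝ≥0∞)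

/-- The Orlicz–Morrey quasinorm
`sup_{x, r > 0} Φ⁻¹(|B(x,r)|^{-lam/n}) ‖f χ_{B(x,r)}‖_{L^Φ}`. -/
noncomputable def orliczMorreyNorm {n : ℕ} (Φ : ℝ≥0 → ℝ≥0∞) (lam : ℝ)
    (f : EuclideanSpace ℝ (Fin n) → ℝ) : ℝ≥0∞ :=
  ⨆ (x : EuclideanSpace ℝ (Fin n)) (r : ℝ) (_ : 0 < r),
    youngInv Φ (volume (Metric.ball x r) ^ (-(lam / n))) *
      orliczNorm Φ ((Metric.ball x r).indicator f)

/-- Membership in the Orlicz–Morrey space `M^{Φ,lam}(ℝⁿ)`. -/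
def MemOrliczMorrey {n : ℕ} (Φ : ℝ≥0 → ℝ≥0∞) (lam : ℝ)
    (f : EuclideanSpace ℝ (Fin n) → ℝ) : Prop :=
  MemOrliczLoc Φ f ∧ orliczMorreyNorm Φ lam f < ∞

/-- The fractional maximal function
`M_α f(x) = sup_{t > 0} |B(x,t)|^{-1+α/n} ∫_{B(x,t)} |f(y)| dy`, with values in `[0, ∞]`. -/
noncomputable def fracMaximal {n : ℕ} (α : ℝ) (f : EuclideanSpace ℝ (Fin n) → ℝ)
    (x : EuclideanSpace ℝ (Fin n)) : ℝ≥0∞ :=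
  ⨆ (t : ℝ) (_ : 0 < t),
    volume (Metric.ball x t) ^ (-1 + α / n) * ∫⁻ y in Metric.ball x t, ‖f y‖ₑ

/-- `M_α` is bounded from `M^{Φ,lam}(ℝⁿ)` to `M^{Ψ,lam}(ℝⁿ)`: for `f` in the first space, `M_α f`
is finite almost everywhere, it belongs to the second space, and the norm inequality holds. -/
def FracMaximalBounded (n : ℕ) (α lam : ℝ) (Φ Ψ : ℝ≥0 → ℝ≥0∞) : Prop :=
  ∃ C : ℝ≥0, ∀ f : EuclideanSpace ℝ (Fin n) → ℝ, MemOrliczMorrey Φ lam f →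
    (∀ᵐ x, fracMaximal α f x < ∞) ∧
    MemOrliczMorrey Ψ lam (fun x => (fracMaximal α f x).toReal) ∧
    orliczMorreyNorm Ψ lam (fun x => (fracMaximal α f x).toReal) ≤
      C * orliczMorreyNorm Φ lam f

/-- The function `t ↦ Φ⁻¹(t^{-n}) / Φ⁻¹(t^{-lam})`, for `t > 0`. -/
noncomputable def invRatio (n : ℕ) (lam : ℝ) (Φ : ℝ≥0 → ℝ≥0∞) (t : ℝ≥0) : ℝ≥0∞ :=
  youngInv Φ ((t : ℝ≥0∞) ^ (-(n : ℝ))) / youngInv Φ ((t : ℝ≥0∞) ^ (-lam))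

end OrliczMorrey

/-! Write `ρ(t)` for the ratio of `Φ⁻¹(|B|⁻¹)` to `Φ⁻¹(|B|^(-lam/n))` over a ball of radius `t`
(`ballRatio`); it is comparable to `invRatio`. Since `r^α` increases, the regularity hypothesis
makes `ρ` almost decreasing (`exists_ballRatio_le`).

Sufficiency is a Hedberg argument. An average of `|f|` over a ball of radius `t` is at most `M f`,
and by Hölder's inequality at most `2 ρ(t) ‖f‖`. Splitting it as `avg^β * avg^(1-β)` and using `t^α
≤ C ρ(t)^(β-1)` cancels `ρ` and leaves `M_α f ≤ C ‖f‖^(1-β) (M f)^β` (`exists_fracMaximal_le`). As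
`Ψ(s^β) = Φ(s)`, the `Ψ`-norm of `(M f)^β` is controlled by the `β`-th power of the `Φ`-norm of `M
f`, so it remains to bound `M` on the Orlicz–Morrey space (`exists_morreyNorm_ballMax_le`). There
small radii are handled by the `L^Φ` bound, which comes from `∇₂` and the weak type inequality, and
large radii by the almost monotonicity of `ρ`.

Necessity tests the operator on the indicator of a ball of radius `t`: its norm is at most `D /
ρ(t)`, while its fractional maximal function is at least a multiple of `t^α` on the ball.

Convexity enters only through `Φ(θ r) ≤ θ Φ(r)` for `θ ≤ 1`, a property that passes to `Ψ`. Maximal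
functions are kept `[0, ∞]`-valued, with `Φ` extended to `∞`, until finiteness almost everywhere is
known. -/

namespace OrliczMorrey

/-! ### Balls, measurability of maximal functions, weak type inequality -/

/-- The centred Hardy–Littlewood maximal function of a nonnegative function. -/
noncomputable def ballMax {n : ℕ} (h : EuclideanSpace ℝ (Fin n) → ℝ≥0∞)
    (x : EuclideanSpace ℝ (Fin n)) : ℝ≥0∞ :=
  ⨆ (t : ℝ) (_ : 0 < t), (volume (Metric.ball x t))⁻¹ * ∫⁻ y in Metric.ball x t, h y

theorem volume_ball_eq {n : ℕ} (x : EuclideanSpace ℝ (Fin n)) {r : ℝ} (hr : 0 < r) :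
    volume (Metric.ball x r) =
      ENNReal.ofReal r ^ n * volume (Metric.ball (0 : EuclideanSpace ℝ (Fin n)) 1) := by
  rw [Measure.addHaar_ball_of_pos _ _ hr, finrank_euclideanSpace_fin, ENNReal.ofReal_pow hr.le]

theorem volume_ball_ne_zero {n : ℕ} (x : EuclideanSpace ℝ (Fin n)) {r : ℝ} (hr : 0 < r) :
    volume (Metric.ball x r) ≠ 0 :=
  (Metric.measure_ball_pos _ _ hr).ne'

theorem volume_ball_ne_top {n : ℕ} (x : EuclideanSpace ℝ (Fin n)) (r : ℝ) :
    volume (Metric.ball x r) ≠ ∞ :=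
  measure_ball_lt_top.ne

theorem volume_ball_mul {n : ℕ} (x y : EuclideanSpace ℝ (Fin n)) {r c : ℝ} (hr : 0 < r)
    (hc : 0 < c) :
    volume (Metric.ball x (c * r)) = ENNReal.ofReal c ^ n * volume (Metric.ball y r) := by
  rw [volume_ball_eq x (mul_pos hc hr), volume_ball_eq y hr, ENNReal.ofReal_mul hc.le, mul_pow,
    mul_assoc]

theorem volume_ball_center {n : ℕ} (x y : EuclideanSpace ℝ (Fin n)) {r : ℝ} (hr : 0 < r) :
    volume (Metric.ball x r) = volume (Metric.ball y r) := by
  rw [volume_ball_eq x hr, volume_ball_eq y hr]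

theorem le_ballMax {n : ℕ} (h : EuclideanSpace ℝ (Fin n) → ℝ≥0∞)
    (x : EuclideanSpace ℝ (Fin n)) {t : ℝ} (ht : 0 < t) :
    (volume (Metric.ball x t))⁻¹ * ∫⁻ y in Metric.ball x t, h y ≤ ballMax h x :=
  le_iSup₂ (f := fun (t : ℝ) (_ : 0 < t) =>
    (volume (Metric.ball x t))⁻¹ * ∫⁻ y in Metric.ball x t, h y) t ht

/-- An open ball is exhausted by smaller concentric balls, and each of these lies in the ball of
radius `t` about any nearby centre. -/
theorem lowerSemicontinuous_lintegral_ball {n : ℕ} (h : EuclideanSpace ℝ (Fin n) → ℝ≥0∞)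
    (t : ℝ) : LowerSemicontinuous fun x => ∫⁻ y in Metric.ball x t, h y := by
  intro x y hy
  have hU : Metric.ball x t = ⋃ k : ℕ, Metric.ball x (t - 1 / ((k : ℝ) + 1)) := by
    ext z
    simp only [Metric.mem_ball, mem_iUnion]
    constructor
    · intro hz
      obtain ⟨k, hk⟩ := exists_nat_one_div_lt (sub_pos.2 hz)
      exact ⟨k, by linarith⟩
    · rintro ⟨k, hk⟩
      have : 0 < 1 / ((k : ℝ) + 1) := by positivity
      linarith
  have hmono : Monotone fun k : ℕ => Metric.ball x (t - 1 / ((k : ℝ) + 1)) := by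
    intro i j hij
    apply Metric.ball_subset_ball
    have : 1 / ((j : ℝ) + 1) ≤ 1 / ((i : ℝ) + 1) :=
      one_div_le_one_div_of_le (by positivity) (by exact_mod_cast Nat.succ_le_succ hij)
    linarith
  have key : ∫⁻ z in Metric.ball x t, h z =
      ⨆ k : ℕ, ∫⁻ z in Metric.ball x (t - 1 / ((k : ℝ) + 1)), h z := by
    -- Continuity from below of the measure with density `h` needs no measurability of `h`.
    have := hmono.measure_iUnion (μ := volume.withDensity h)
    rw [← hU, withDensity_apply _ measurableSet_ball] at this
    rw [this]
    exact iSup_congr fun k => withDensity_apply _ measurableSet_ball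
  simp only [key] at hy
  obtain ⟨k, hk⟩ := lt_iSup_iff.1 hy
  have hpos : 0 < 1 / ((k : ℝ) + 1) := by positivity
  filter_upwards [Metric.ball_mem_nhds x hpos] with z hz
  refine hk.trans_le (lintegral_mono_set fun w hw => ?_)
  rw [Metric.mem_ball] at *
  have := dist_triangle w x z
  rw [dist_comm x z] at this
  linarith

theorem measurable_iSup_ball {n : ℕ} (c : ℝ → ℝ≥0∞) (hc : ∀ t, c t ≠ ∞)
    (h : EuclideanSpace ℝ (Fin n) → ℝ≥0∞) :
    Measurable fun x => ⨆ (t : ℝ) (_ : 0 < t), c t * ∫⁻ y in Metric.ball x t, h y := by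
  apply LowerSemicontinuous.measurable
  refine lowerSemicontinuous_iSup fun t => lowerSemicontinuous_iSup fun ht => ?_
  exact (ENNReal.continuous_const_mul (hc t)).comp_lowerSemicontinuous
    (lowerSemicontinuous_lintegral_ball h t) (fun a b hab => mul_le_mul' le_rfl hab)

theorem measurable_iSup_volume_ball {n : ℕ} (p : ℝ) (h : EuclideanSpace ℝ (Fin n) → ℝ≥0∞) :
    Measurable fun x => ⨆ (t : ℝ) (_ : 0 < t),
      volume (Metric.ball x t) ^ p * ∫⁻ y in Metric.ball x t, h y := by
  -- For `t ≤ 0` the ball is empty and a negative power of its volume is `∞`; the value `0` keeps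
  -- all coefficients finite.
  have := measurable_iSup_ball (n := n) (fun t => if 0 < t then
    volume (Metric.ball (0 : EuclideanSpace ℝ (Fin n)) t) ^ p else 0) (fun t => ?_) h
  · convert this using 6 with x t ht
    rw [if_pos ht, volume_ball_center x 0 ht]
  · split_ifs with ht
    · exact ENNReal.rpow_ne_top_of_ne_zero (volume_ball_ne_zero _ ht) (volume_ball_ne_top _ _)
    · simp

theorem measurable_ballMax {n : ℕ} (h : EuclideanSpace ℝ (Fin n) → ℝ≥0∞) :
    Measurable (ballMax h) := by
  unfold ballMax
  simpa only [ENNReal.rpow_neg_one] using measurable_iSup_volume_ball (-1) h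

theorem measurable_fracMaximal {n : ℕ} (α : ℝ) (f : EuclideanSpace ℝ (Fin n) → ℝ) :
    Measurable (fracMaximal α f) :=
  measurable_iSup_volume_ball _ _

/-- The weak type `(1, 1)` inequality. -/
theorem mul_volume_lt_ballMax_le {n : ℕ} (hn : n ≠ 0) (h : EuclideanSpace ℝ (Fin n) → ℝ≥0∞)
    (s : ℝ≥0∞) (hs : s ≠ 0) :
    s * volume {x | s < ballMax h x} ≤ 4 ^ n * ∫⁻ y, h y := by
  rcases eq_or_ne s ∞ with rfl | hs'
  · simp
  rcases eq_or_ne (∫⁻ y, h y) ∞ with hL | hL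
  · rw [hL, ENNReal.mul_top (by positivity)]
    exact le_top
  have hex : ∀ x, s < ballMax h x →
      ∃ t : ℝ, 0 < t ∧ s * volume (Metric.ball x t) ≤ ∫⁻ y in Metric.ball x t, h y := by
    intro x hx
    obtain ⟨t, hx⟩ := lt_iSup_iff.1 hx
    obtain ⟨ht, hx⟩ := lt_iSup_iff.1 hx
    refine ⟨t, ht, ?_⟩
    rw [mul_comm, ← div_eq_mul_inv] at hx
    exact (ENNReal.le_div_iff_mul_le (Or.inl (volume_ball_ne_zero _ ht))
      (Or.inl (volume_ball_ne_top _ _))).1 hx.le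
  choose! r hr0 hr using hex
  set T := {x | s < ballMax h x}
  set b := volume (Metric.ball (0 : EuclideanSpace ℝ (Fin n)) 1)
  have hb0 : b ≠ 0 := volume_ball_ne_zero _ one_pos
  have hbt : b ≠ ∞ := volume_ball_ne_top _ _
  -- Vitali's lemma needs bounded radii. Here `s * |B| ≤ ∫ h` bounds `r ^ n`, hence `r` once `r ≥
  -- 1`, because `n ≠ 0`.
  have hR : ∀ x ∈ T, r x ≤ max 1 ((∫⁻ y, h y) / (s * b)).toReal := by
    intro x hx
    rcases le_total (r x) 1 with h1 | h1
    · exact h1.trans (le_max_left _ _)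
    refine le_trans ?_ (le_max_right _ _)
    rw [← ENNReal.ofReal_le_iff_le_toReal (ENNReal.div_ne_top hL (by positivity)),
      ENNReal.le_div_iff_mul_le (Or.inl (by positivity)) (Or.inl (ENNReal.mul_ne_top hs' hbt))]
    calc ENNReal.ofReal (r x) * (s * b) ≤ ENNReal.ofReal (r x) ^ n * (s * b) := by
          gcongr
          exact le_self_pow₀ (by simpa using h1) hn
      _ = s * volume (Metric.ball x (r x)) := by rw [volume_ball_eq x (hr0 x hx)]; ring
      _ ≤ ∫⁻ y in Metric.ball x (r x), h y := hr x hx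
      _ ≤ ∫⁻ y, h y := setLIntegral_le_lintegral _ _
  -- Any enlargement factor above `3` is allowed; `4` is the source of the constant `4 ^ n`.
  obtain ⟨u, huT, hdisj, hcov⟩ := Vitali.exists_disjoint_subfamily_covering_enlargement_ball T
    (fun x => x) r _ hR 4 (by norm_num)
  have hucount : u.Countable := hdisj.countable_of_isOpen (fun _ _ => Metric.isOpen_ball)
    (fun x hx => ⟨x, Metric.mem_ball_self (hr0 x (huT hx))⟩)
  have hTsub : T ⊆ ⋃ x ∈ u, Metric.ball x (4 * r x) := by
    intro x hx
    obtain ⟨y, hy, hxy⟩ := hcov x hx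
    exact mem_biUnion hy (hxy (Metric.mem_ball_self (hr0 x hx)))
  calc s * volume T ≤ s * ∑' x : u, volume (Metric.ball (x : EuclideanSpace ℝ (Fin n)) (4 * r x)) := by
        gcongr
        exact (measure_mono hTsub).trans (measure_biUnion_le _ hucount _)
    _ = ∑' x : u, 4 ^ n * (s * volume (Metric.ball (x : EuclideanSpace ℝ (Fin n)) (r x))) := by
        rw [← ENNReal.tsum_mul_left]
        refine tsum_congr fun x => ?_
        rw [volume_ball_mul (x : EuclideanSpace ℝ (Fin n)) x (hr0 x (huT x.2)) (c := 4) (by norm_num)]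
        simp only [ENNReal.ofReal_ofNat]
        ring
    _ ≤ ∑' x : u, 4 ^ n * ∫⁻ y in Metric.ball (x : EuclideanSpace ℝ (Fin n)) (r x), h y := by
        gcongr with x
        exact hr x (huT x.2)
    _ = 4 ^ n * ∫⁻ y in ⋃ x ∈ u, Metric.ball x (r x), h y := by
        rw [ENNReal.tsum_mul_left, lintegral_biUnion hucount (fun _ _ => measurableSet_ball) hdisj]
    _ ≤ 4 ^ n * ∫⁻ y, h y := by
        gcongr
        exact Measure.restrict_le_self

/-! ### Star-shaped functions and their extension to `[0, ∞]` -/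

/-- Functions `[0, ∞) → [0, ∞]` that are star-shaped with respect to the origin, tend to `0` at `0`
and to `∞` at `∞`. Every Young function is of this kind. -/
structure IsStarShaped (Φ : ℝ≥0 → ℝ≥0∞) : Prop where
  star : ∀ θ : ℝ≥0, θ ≤ 1 → ∀ r, Φ (θ * r) ≤ θ * Φ r
  tendsto_zero : Tendsto Φ (𝓝[>] 0) (𝓝 0)
  tendsto_top : Tendsto Φ atTop (𝓝 ∞)

theorem IsYoung.isStarShaped {Φ : ℝ≥0 → ℝ≥0∞} (hΦ : IsYoung Φ) : IsStarShaped Φ where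
  star θ hθ r := by
    have := hΦ.convex.2 (mem_univ r) (mem_univ 0) zero_le zero_le
      (add_tsub_cancel_of_le hθ)
    simpa [hΦ.map_zero, ENNReal.smul_def] using this
  tendsto_zero := hΦ.tendsto_zero
  tendsto_top := hΦ.tendsto_top

namespace IsStarShaped

variable {Φ : ℝ≥0 → ℝ≥0∞}

theorem map_zero (hΦ : IsStarShaped Φ) : Φ 0 = 0 := by
  simpa using hΦ.star 0 zero_le_one 0

theorem monotone (hΦ : IsStarShaped Φ) : Monotone Φ := by
  intro a b hab
  rcases eq_or_ne b 0 with rfl | hb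
  · rw [le_antisymm hab zero_le]
  have h1 : a / b ≤ 1 := div_le_one_of_le₀ hab zero_le
  calc Φ a = Φ (a / b * b) := by rw [div_mul_cancel₀ _ hb]
    _ ≤ (a / b : ℝ≥0) * Φ b := hΦ.star _ h1 _
    _ ≤ 1 * Φ b := by gcongr; exact_mod_cast h1
    _ = Φ b := one_mul _

/-- Holds because `θ ^ p ≤ θ` for `θ ≤ 1 ≤ p`. With `p = 1 / β` it puts `Ψ` in the same class as
`Φ`. -/
theorem comp_rpow (hΦ : IsStarShaped Φ) {p : ℝ} (hp : 1 ≤ p) :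
    IsStarShaped fun t => Φ (t ^ p) where
  star θ hθ r := by
    rw [NNReal.mul_rpow]
    refine (hΦ.star _ (NNReal.rpow_le_one hθ (by linarith)) _).trans ?_
    gcongr
    rcases eq_or_ne θ 0 with rfl | h0
    · rw [NNReal.zero_rpow (by linarith)]
    · simpa using NNReal.rpow_le_rpow_of_exponent_ge (pos_iff_ne_zero.2 h0) hθ hp
  tendsto_zero := by
    refine hΦ.tendsto_zero.comp (tendsto_nhdsWithin_iff.2 ⟨?_, ?_⟩)
    · have := (NNReal.continuous_rpow_const (y := p) (by linarith)).tendsto 0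
      rw [NNReal.zero_rpow (by linarith)] at this
      exact this.mono_left nhdsWithin_le_nhds
    · filter_upwards [self_mem_nhdsWithin] with t ht
      exact NNReal.rpow_pos ht
  tendsto_top := hΦ.tendsto_top.comp (NNReal.tendsto_rpow_atTop (by linarith))

end IsStarShaped

/-- The monotone extension of `Φ` to `[0, ∞]`. -/
noncomputable def extend (Φ : ℝ≥0 → ℝ≥0∞) (x : ℝ≥0∞) : ℝ≥0∞ :=
  ⨆ (r : ℝ≥0) (_ : (r : ℝ≥0∞) ≤ x), Φ r

section extend

variable {Φ : ℝ≥0 → ℝ≥0∞}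

theorem extend_mono : Monotone (extend Φ) := fun _ _ hab =>
  iSup₂_le fun r hr => le_iSup₂ (f := fun (r : ℝ≥0) (_ : (r : ℝ≥0∞) ≤ _) => Φ r) r (hr.trans hab)

theorem measurable_extend : Measurable (extend Φ) := extend_mono.measurable

theorem le_extend {r : ℝ≥0} {x : ℝ≥0∞} (h : (r : ℝ≥0∞) ≤ x) : Φ r ≤ extend Φ x :=
  le_iSup₂ (f := fun (r : ℝ≥0) (_ : (r : ℝ≥0∞) ≤ x) => Φ r) r h

theorem extend_coe (hΦ : IsStarShaped Φ) (r : ℝ≥0) : extend Φ r = Φ r :=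
  le_antisymm (iSup₂_le fun _ hs => hΦ.monotone (ENNReal.coe_le_coe.1 hs)) (le_extend le_rfl)

theorem extend_zero (hΦ : IsStarShaped Φ) : extend Φ 0 = 0 := by
  simpa [hΦ.map_zero] using extend_coe hΦ 0

theorem extend_top (hΦ : IsStarShaped Φ) : extend Φ ∞ = ∞ := by
  refine top_le_iff.1 (le_of_tendsto hΦ.tendsto_top (Eventually.of_forall fun r => ?_))
  exact le_extend le_top

theorem extend_mul_le (hΦ : IsStarShaped Φ) {θ : ℝ≥0} (hθ : θ ≤ 1) (x : ℝ≥0∞) :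
    extend Φ (θ * x) ≤ θ * extend Φ x := by
  refine iSup₂_le fun r hr => ?_
  rcases eq_or_ne θ 0 with rfl | h0
  · have : r = 0 := by simpa using hr
    simp [this, hΦ.map_zero]
  have h1 : ((r / θ : ℝ≥0) : ℝ≥0∞) ≤ x := by
    rw [ENNReal.coe_div h0]
    exact ENNReal.div_le_of_le_mul' hr
  calc Φ r = Φ (θ * (r / θ)) := by rw [mul_div_cancel₀ _ h0]
    _ ≤ θ * Φ (r / θ) := hΦ.star θ hθ _
    _ ≤ θ * extend Φ x := by gcongr; exact le_extend h1

theorem extend_max_le (a b : ℝ≥0∞) : extend Φ (max a b) ≤ extend Φ a + extend Φ b := by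
  rcases le_total a b with h | h
  · rw [max_eq_right h]; exact le_add_self
  · rw [max_eq_left h]; exact le_self_add

theorem extend_rpow_le {β : ℝ} (hβ : 0 < β) (x : ℝ≥0∞) :
    extend (fun t => Φ (t ^ (1 / β))) (x ^ β) ≤ extend Φ x := by
  refine iSup₂_le fun r hr => le_extend ?_
  rw [ENNReal.coe_rpow_of_nonneg _ (by positivity), one_div]
  exact (ENNReal.rpow_inv_le_iff hβ).2 hr

end extend

/-! ### The generalized inverse -/

section youngInv

variable {Φ : ℝ≥0 → ℝ≥0∞} {s : ℝ≥0∞}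

theorem youngInv_le {r : ℝ≥0} (h : s < Φ r) : youngInv Φ s ≤ r :=
  iInf₂_le (f := fun (r : ℝ≥0) (_ : s < Φ r) => (r : ℝ≥0∞)) r h

theorem le_of_lt_youngInv {r : ℝ≥0} (h : r < youngInv Φ s) : Φ r ≤ s :=
  not_lt.1 fun h' => (youngInv_le h').not_gt h

theorem le_youngInv (hΦ : IsStarShaped Φ) {r : ℝ≥0} (h : Φ r ≤ s) : r ≤ youngInv Φ s :=
  le_iInf₂ fun q hq => by
    by_contra! hlt
    exact (hq.trans_le (hΦ.monotone (ENNReal.coe_le_coe.1 hlt.le))).not_ge h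

theorem youngInv_mono : Monotone (youngInv Φ) := fun _ _ hst =>
  le_iInf₂ fun _ hq => youngInv_le (hst.trans_lt hq)

theorem youngInv_ne_zero (hΦ : IsStarShaped Φ) (hs : s ≠ 0) : youngInv Φ s ≠ 0 := by
  have h := (hΦ.tendsto_zero.eventually (ge_mem_nhds (pos_iff_ne_zero.2 hs))).and
    self_mem_nhdsWithin
  obtain ⟨r, hr, hr0⟩ := h.exists
  exact ((ENNReal.coe_pos.2 hr0).trans_le (le_youngInv hΦ hr)).ne'

theorem youngInv_ne_top (hΦ : IsStarShaped Φ) (hs : s ≠ ∞) : youngInv Φ s ≠ ∞ := by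
  obtain ⟨r, hr⟩ := (hΦ.tendsto_top.eventually (lt_mem_nhds hs.lt_top)).exists
  exact ((youngInv_le hr).trans_lt ENNReal.coe_lt_top).ne

/-- Star-shapedness gives `c * Φ q ≤ Φ (c * q)`. This doubling property lets dimensional constants
inside `Φ⁻¹` be moved outside. -/
theorem youngInv_mul_le (hΦ : IsStarShaped Φ) {c : ℝ≥0} (hc : 1 ≤ c) (s : ℝ≥0∞) :
    youngInv Φ (c * s) ≤ c * youngInv Φ s := by
  have hc0 : c ≠ 0 := (zero_lt_one.trans_le hc).ne'
  rw [← ENNReal.div_le_iff' (by simpa using hc0) ENNReal.coe_ne_top]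
  refine le_iInf₂ fun q hq => ?_
  refine ENNReal.div_le_of_le_mul' ?_
  rw [← ENNReal.coe_mul]
  apply youngInv_le
  have h := hΦ.star c⁻¹ (inv_le_one_of_one_le₀ hc) (c * q)
  rw [inv_mul_cancel_left₀ hc0, ENNReal.coe_inv hc0] at h
  refine ((ENNReal.mul_lt_mul_iff_right (by simpa using hc0) ENNReal.coe_ne_top).2
    (hq.trans_le h)).trans_le ?_
  rw [← mul_assoc, ENNReal.mul_inv_cancel (by simpa using hc0) ENNReal.coe_ne_top, one_mul]

/-- The power `x ↦ x ^ β` is an order isomorphism of `[0, ∞]`, so it commutes with the infimum. -/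
theorem youngInv_rpow {β : ℝ} (hβ : 0 < β) (s : ℝ≥0∞) :
    youngInv (fun t => Φ (t ^ (1 / β))) s = youngInv Φ s ^ β := by
  apply le_antisymm
  · have h : youngInv Φ s ^ β = ENNReal.orderIsoRpow β hβ (youngInv Φ s) := rfl
    rw [h, youngInv, youngInv, OrderIso.map_iInf]
    simp only [OrderIso.map_iInf]
    refine le_iInf₂ fun q hq => ?_
    rw [ENNReal.orderIsoRpow_apply, ← ENNReal.coe_rpow_of_nonneg _ hβ.le]
    refine iInf₂_le (f := fun (r : ℝ≥0) (_ : s < Φ (r ^ (1 / β))) => (r : ℝ≥0∞)) (q ^ β) ?_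
    rwa [← NNReal.rpow_mul, mul_one_div_cancel hβ.ne', NNReal.rpow_one]
  · refine le_iInf₂ fun r hr => ?_
    have := youngInv_le hr
    rw [ENNReal.coe_rpow_of_nonneg _ (by positivity), one_div] at this
    rwa [← ENNReal.le_rpow_inv_iff hβ]

end youngInv

/-! ### The Luxemburg norm -/

/-- The Luxemburg norm of a nonnegative extended-real-valued function. -/
noncomputable def luxNorm {n : ℕ} (Φ : ℝ≥0 → ℝ≥0∞)
    (h : EuclideanSpace ℝ (Fin n) → ℝ≥0∞) : ℝ≥0∞ :=
  ⨅ (c : ℝ≥0) (_ : 0 < c ∧ ∫⁻ x, extend Φ (h x / c) ≤ 1), (c : ℝ≥0∞)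

section luxNorm

variable {n : ℕ} {Φ : ℝ≥0 → ℝ≥0∞} {h h₁ h₂ : EuclideanSpace ℝ (Fin n) → ℝ≥0∞}

theorem orliczNorm_eq_luxNorm (hΦ : IsStarShaped Φ) (f : EuclideanSpace ℝ (Fin n) → ℝ) :
    orliczNorm Φ f = luxNorm Φ fun x => ‖f x‖ₑ := by
  unfold orliczNorm luxNorm
  refine iInf_congr fun c => iInf_congr_Prop (and_congr_right fun hc => ?_) fun _ => rfl
  have : ∀ x, Φ (‖f x‖₊ / c) = extend Φ (‖f x‖ₑ / c) := fun x => by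
    rw [enorm_eq_nnnorm, ← ENNReal.coe_div hc.ne', extend_coe hΦ]
  simp only [this]

theorem luxNorm_le {c : ℝ≥0} (hc : 0 < c) (hi : ∫⁻ x, extend Φ (h x / c) ≤ 1) :
    luxNorm Φ h ≤ c :=
  iInf₂_le (f := fun (c : ℝ≥0) (_ : 0 < c ∧ ∫⁻ x, extend Φ (h x / c) ≤ 1) => (c : ℝ≥0∞))
    c ⟨hc, hi⟩

theorem lintegral_le_one_of_luxNorm_lt {c : ℝ≥0} (hc : luxNorm Φ h < c) :
    ∫⁻ x, extend Φ (h x / c) ≤ 1 := by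
  obtain ⟨d, hd⟩ := iInf_lt_iff.1 hc
  obtain ⟨⟨_, hd1⟩, hdc⟩ := iInf_lt_iff.1 hd
  refine (lintegral_mono fun x => extend_mono ?_).trans hd1
  exact ENNReal.div_le_div_left hdc.le _

theorem luxNorm_mono (hle : ∀ᵐ x, h₁ x ≤ h₂ x) : luxNorm Φ h₁ ≤ luxNorm Φ h₂ :=
  le_iInf₂ fun _ hc => luxNorm_le hc.1 <| (lintegral_mono_ae <| hle.mono fun _ hx =>
    extend_mono (ENNReal.div_le_div_right hx _)).trans hc.2

theorem luxNorm_zero (hΦ : IsStarShaped Φ) :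
    luxNorm Φ (fun _ : EuclideanSpace ℝ (Fin n) => 0) = 0 := by
  refine nonpos_iff_eq_zero.1 (le_of_forall_gt_imp_ge_of_dense fun c hc => ?_)
  rcases eq_or_ne c ∞ with rfl | hct
  · exact le_top
  lift c to ℝ≥0 using hct
  exact luxNorm_le (by simpa using hc) (by simp [extend_zero hΦ])

theorem luxNorm_const_mul_le (hΦ : IsStarShaped Φ) {a : ℝ≥0∞} (ha : a ≠ ∞) :
    luxNorm Φ (fun x => a * h x) ≤ a * luxNorm Φ h := by
  lift a to ℝ≥0 using ha
  rcases eq_or_ne a 0 with rfl | h0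
  · simp [luxNorm_zero hΦ]
  have h0' : (a : ℝ≥0∞) ≠ 0 := by simpa using h0
  rw [← ENNReal.div_le_iff' h0' ENNReal.coe_ne_top]
  refine le_iInf₂ fun c hc => ENNReal.div_le_of_le_mul' ?_
  rw [← ENNReal.coe_mul]
  refine luxNorm_le (mul_pos (pos_iff_ne_zero.2 h0) hc.1) ?_
  convert hc.2 using 4 with x
  rw [ENNReal.coe_mul, ENNReal.mul_div_mul_left _ _ h0' ENNReal.coe_ne_top]

/-- The factor `2` pays for the sum of two modulars, since `Φ(x / 2) ≤ Φ(x) / 2`. -/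
theorem luxNorm_le_two_mul_max (hΦ : IsStarShaped Φ) (hm : AEMeasurable h₁)
    (hle : ∀ᵐ x, h x ≤ max (h₁ x) (h₂ x)) :
    luxNorm Φ h ≤ 2 * max (luxNorm Φ h₁) (luxNorm Φ h₂) := by
  rw [← ENNReal.div_le_iff' (by simp) (by simp)]
  refine le_of_forall_gt_imp_ge_of_dense fun c hc => ENNReal.div_le_of_le_mul' ?_
  rcases eq_or_ne c ∞ with rfl | hct
  · simp
  lift c to ℝ≥0 using hct
  have hc1 := lintegral_le_one_of_luxNorm_lt ((le_max_left _ _).trans_lt hc)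
  have hc2 := lintegral_le_one_of_luxNorm_lt ((le_max_right _ _).trans_lt hc)
  have hc0 : 0 < c := by simpa using zero_le.trans_lt hc
  rw [← ENNReal.coe_ofNat, ← ENNReal.coe_mul]
  refine luxNorm_le (by positivity) ?_
  have hhalf : ((2⁻¹ : ℝ≥0) : ℝ≥0∞) = 2⁻¹ := by simp
  calc ∫⁻ x, extend Φ (h x / ((2 * c : ℝ≥0) : ℝ≥0∞))
      ≤ ∫⁻ x, ((2⁻¹ : ℝ≥0) : ℝ≥0∞) * (extend Φ (h₁ x / c) + extend Φ (h₂ x / c)) := by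
        refine lintegral_mono_ae (hle.mono fun x hx => ?_)
        calc extend Φ (h x / ((2 * c : ℝ≥0) : ℝ≥0∞))
            ≤ extend Φ (((2⁻¹ : ℝ≥0) : ℝ≥0∞) * max (h₁ x / c) (h₂ x / c)) := by
              refine extend_mono ?_
              rw [ENNReal.coe_mul, hhalf, ENNReal.coe_ofNat, ENNReal.div_eq_inv_mul,
                ENNReal.mul_inv (by simp) (by simp), mul_assoc]
              gcongr
              rw [← ENNReal.div_eq_inv_mul]
              refine (ENNReal.div_le_div_right hx _).trans ?_
              rcases le_total (h₁ x) (h₂ x) with h12 | h12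
              · rw [max_eq_right h12]; exact le_max_right _ _
              · rw [max_eq_left h12]; exact le_max_left _ _
          _ ≤ ((2⁻¹ : ℝ≥0) : ℝ≥0∞) * extend Φ (max (h₁ x / c) (h₂ x / c)) :=
              extend_mul_le hΦ (by rw [← NNReal.coe_le_coe]; norm_num) _
          _ ≤ _ := by gcongr; exact extend_max_le _ _
    _ = 2⁻¹ * ((∫⁻ x, extend Φ (h₁ x / c)) + ∫⁻ x, extend Φ (h₂ x / c)) := by
        rw [lintegral_const_mul' _ _ ENNReal.coe_ne_top, lintegral_add_left', hhalf]
        exact measurable_extend.comp_aemeasurable (hm.div_const _)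
    _ ≤ 2⁻¹ * (1 + 1) := by gcongr
    _ = 1 := by rw [one_add_one_eq_two, ENNReal.inv_mul_cancel (by simp) (by simp)]

theorem luxNorm_indicator_one_le (hΦ : IsStarShaped Φ) {B : Set (EuclideanSpace ℝ (Fin n))}
    (hB : MeasurableSet B) (hB0 : volume B ≠ 0) (hBt : volume B ≠ ∞) :
    luxNorm Φ (B.indicator fun _ => 1) ≤ (youngInv Φ (volume B)⁻¹)⁻¹ := by
  refine le_of_forall_gt_imp_ge_of_dense fun c hc => ?_
  rcases eq_or_ne c ∞ with rfl | hct
  · simp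
  lift c to ℝ≥0 using hct
  have hc0 : 0 < c := by simpa using zero_le.trans_lt hc
  refine luxNorm_le hc0 ?_
  have h1 : Φ c⁻¹ ≤ (volume B)⁻¹ := by
    apply le_of_lt_youngInv
    rw [ENNReal.coe_inv hc0.ne']
    exact ENNReal.inv_lt_iff_inv_lt.1 hc
  calc ∫⁻ x, extend Φ (B.indicator (fun _ => 1) x / c)
      = ∫⁻ x, B.indicator (fun _ => Φ c⁻¹) x := by
        congr! with x
        by_cases hx : x ∈ B
        · rw [indicator_of_mem hx, indicator_of_mem hx, ← extend_coe hΦ, one_div,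
            ENNReal.coe_inv hc0.ne']
        · rw [indicator_of_notMem hx, indicator_of_notMem hx, ENNReal.zero_div, extend_zero hΦ]
    _ = Φ c⁻¹ * volume B := lintegral_indicator_const hB _
    _ ≤ (volume B)⁻¹ * volume B := by gcongr
    _ = 1 := ENNReal.inv_mul_cancel hB0 hBt

/-- Beyond `u = Φ⁻¹(s)` the quotient `Φ(x) / x` is nondecreasing and at least `s / u`, so `x ≤ u *
s⁻¹ * Φ(x)`. This replaces duality with the complementary function in Hölder's inequality. -/
theorem le_youngInv_add_mul_extend (hΦ : IsStarShaped Φ) {s : ℝ≥0∞} (hs0 : s ≠ 0) (hs : s ≠ ∞)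
    (x : ℝ≥0∞) : x ≤ youngInv Φ s + youngInv Φ s * s⁻¹ * extend Φ x := by
  have hu0 := youngInv_ne_zero hΦ hs0
  rcases eq_or_ne x ∞ with rfl | hx
  · rw [extend_top hΦ, ENNReal.mul_top (mul_ne_zero hu0 (ENNReal.inv_ne_zero.2 hs))]
    simp
  lift x to ℝ≥0 using hx
  rcases le_or_gt (x : ℝ≥0∞) (youngInv Φ s) with hxu | hxu
  · exact hxu.trans le_self_add
  refine le_trans ?_ le_add_self
  have hle : s ≤ Φ x := by
    by_contra! hlt
    exact hxu.not_ge (le_youngInv hΦ hlt.le)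
  have hk : 1 ≤ s⁻¹ * Φ x := by
    rw [← ENNReal.inv_mul_cancel hs0 hs]
    gcongr
  rw [extend_coe hΦ, mul_assoc]
  refine (ENNReal.div_le_iff_le_mul (Or.inl (zero_lt_one.trans_le hk).ne') (Or.inr hu0)).1 ?_
  refine le_iInf₂ fun q hq => ENNReal.div_le_of_le_mul ?_
  rcases le_or_gt x q with hxq | hxq
  · calc (x : ℝ≥0∞) ≤ q * 1 := by simpa using hxq
      _ ≤ _ := by gcongr
  have hx0 : x ≠ 0 := (zero_le.trans_lt hxq).ne'
  have h := hΦ.star (q / x) (div_le_one_of_le₀ hxq.le zero_le) x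
  rw [div_mul_cancel₀ _ hx0, ENNReal.coe_div hx0] at h
  calc (x : ℝ≥0∞) = x * (s⁻¹ * s) := by rw [ENNReal.inv_mul_cancel hs0 hs, mul_one]
    _ ≤ x * (s⁻¹ * (q / x * Φ x)) := by gcongr; exact hq.le.trans h
    _ = x / x * (q * (s⁻¹ * Φ x)) := by simp only [div_eq_mul_inv]; ring
    _ = q * (s⁻¹ * Φ x) := by
      rw [ENNReal.div_self (by simpa using hx0) ENNReal.coe_ne_top, one_mul]

/-- Hölder's inequality for the Luxemburg norm of a function on a set of finite measure. -/
theorem setLIntegral_le_luxNorm (hΦ : IsStarShaped Φ) {B : Set (EuclideanSpace ℝ (Fin n))}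
    (hB : MeasurableSet B) (hB0 : volume B ≠ 0) (hBt : volume B ≠ ∞) :
    ∫⁻ x in B, h x ≤
      2 * volume B * youngInv Φ (volume B)⁻¹ * luxNorm Φ (B.indicator h) := by
  have hu0 := youngInv_ne_zero hΦ (ENNReal.inv_ne_zero.2 hBt)
  have hut := youngInv_ne_top hΦ (ENNReal.inv_ne_top.2 hB0)
  rw [← ENNReal.div_le_iff' (mul_ne_zero (mul_ne_zero (by simp) hB0) hu0)
    (ENNReal.mul_ne_top (ENNReal.mul_ne_top (by simp) hBt) hut)]
  refine le_iInf₂ fun c hc => ENNReal.div_le_of_le_mul ?_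
  have hc0 : (c : ℝ≥0∞) ≠ 0 := by simpa using hc.1.ne'
  set u := youngInv Φ (volume B)⁻¹
  have hut' : u * volume B ≠ ∞ := ENNReal.mul_ne_top hut hBt
  -- With `s = |B|⁻¹`, each of the two terms of the pointwise bound for `h / c` integrates to at
  -- most `u * |B|`.
  calc ∫⁻ x in B, h x ≤ ∫⁻ x in B, c * (u + u * volume B * extend Φ (h x / c)) := by
        refine lintegral_mono fun x => ?_
        have := le_youngInv_add_mul_extend hΦ (ENNReal.inv_ne_zero.2 hBt)
          (ENNReal.inv_ne_top.2 hB0) (h x / c)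
        rw [inv_inv] at this
        exact (ENNReal.div_le_iff' hc0 ENNReal.coe_ne_top).1 this
    _ = c * (u * volume B + u * volume B * ∫⁻ x in B, extend Φ (h x / c)) := by
        rw [lintegral_const_mul' _ _ ENNReal.coe_ne_top, lintegral_add_left measurable_const,
          setLIntegral_const, lintegral_const_mul' _ _ hut']
    _ ≤ c * (u * volume B + u * volume B * 1) := by
        gcongr
        refine le_trans ?_ hc.2
        rw [← lintegral_indicator hB]
        refine lintegral_mono fun x => ?_
        by_cases hx : x ∈ B <;> simp [hx]
    _ = c * (2 * volume B * u) := by ring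

/-- Chebyshev: an admissible `c` satisfies `Φ(a / c) * |B| ≤ 1`, that is, `a / c ≤ Φ⁻¹(|B|⁻¹)`. -/
theorem le_youngInv_mul_luxNorm (hΦ : IsStarShaped Φ) {B : Set (EuclideanSpace ℝ (Fin n))}
    (hB : MeasurableSet B) (hB0 : volume B ≠ 0) (hBt : volume B ≠ ∞) {a : ℝ≥0}
    (ha : ∀ᵐ x, x ∈ B → a ≤ h x) :
    a ≤ youngInv Φ (volume B)⁻¹ * luxNorm Φ (B.indicator h) := by
  have hu0 := youngInv_ne_zero hΦ (ENNReal.inv_ne_zero.2 hBt)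
  have hut := youngInv_ne_top hΦ (ENNReal.inv_ne_top.2 hB0)
  rw [← ENNReal.div_le_iff' hu0 hut]
  refine le_iInf₂ fun c hc => ENNReal.div_le_of_le_mul' ?_
  have hc0 : (c : ℝ≥0∞) ≠ 0 := by simpa using hc.1.ne'
  rw [← ENNReal.div_le_iff hc0 ENNReal.coe_ne_top, ← ENNReal.coe_div hc.1.ne']
  refine le_youngInv hΦ ?_
  rw [ENNReal.le_inv_iff_mul_le]
  refine le_trans ?_ hc.2
  rw [← lintegral_indicator_const hB]
  refine lintegral_mono_ae (ha.mono fun x hx => ?_)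
  by_cases hxB : x ∈ B
  · rw [indicator_of_mem hxB, indicator_of_mem hxB]
    refine le_extend ?_
    rw [ENNReal.coe_div hc.1.ne']
    exact ENNReal.div_le_div_right (hx hxB) _
  · simp [hxB]

theorem luxNorm_rpow_le {β : ℝ} (hβ : 0 < β) :
    luxNorm (fun t => Φ (t ^ (1 / β))) (fun x => h x ^ β) ≤ luxNorm Φ h ^ β := by
  rw [← ENNReal.rpow_inv_le_iff hβ]
  refine le_iInf₂ fun c hc => ?_
  rw [ENNReal.rpow_inv_le_iff hβ, ← ENNReal.coe_rpow_of_nonneg _ hβ.le]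
  refine luxNorm_le (NNReal.rpow_pos hc.1) ((lintegral_mono fun x => ?_).trans hc.2)
  rw [ENNReal.coe_rpow_of_nonneg _ hβ.le, ← ENNReal.div_rpow_of_nonneg _ _ hβ.le]
  exact extend_rpow_le hβ _

end luxNorm

/-! ### The maximal operator on `L^Φ` -/

variable {n : ℕ} {Φ : ℝ≥0 → ℝ≥0∞}

/-- Iterating `∇₂` gains `2⁻¹ ^ i` over linear growth; this makes the sum over levels converge. -/
theorem le_pow_mul_of_nabla {a : ℝ≥0}
    (ha : ∀ r : ℝ≥0, Φ r ≤ 1 / (2 * (a : ℝ≥0∞)) * Φ (a * r)) (i : ℕ) (r : ℝ≥0) :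
    Φ r ≤ (2 * (a : ℝ≥0∞))⁻¹ ^ i * Φ (a ^ i * r) := by
  induction i with
  | zero => simp
  | succ i ih =>
    refine ih.trans ?_
    rw [pow_succ, mul_assoc]
    gcongr
    have := ha (a ^ i * r)
    rwa [one_div, ← mul_assoc, ← pow_succ'] at this

/-- The part of `h` not exceeding `s` contributes at most `s` to every average. -/
theorem ballMax_le_add {h : EuclideanSpace ℝ (Fin n) → ℝ≥0∞} {s : ℝ≥0∞}
    (x : EuclideanSpace ℝ (Fin n)) :
    ballMax h x ≤ ballMax ({y | s < h y}.indicator h) x + s := by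
  refine iSup₂_le fun t ht => ?_
  calc (volume (Metric.ball x t))⁻¹ * ∫⁻ y in Metric.ball x t, h y
      ≤ (volume (Metric.ball x t))⁻¹ *
          ∫⁻ y in Metric.ball x t, ({y | s < h y}.indicator h y + s) := by
        gcongr with y
        by_cases hy : s < h y
        · rw [indicator_of_mem (by exact hy)]; exact le_self_add
        · exact (not_lt.1 hy).trans le_add_self
    _ = (volume (Metric.ball x t))⁻¹ * (∫⁻ y in Metric.ball x t, {y | s < h y}.indicator h y) +
          s := by
        rw [lintegral_add_right _ measurable_const, setLIntegral_const, mul_add,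
          mul_left_comm, ENNReal.inv_mul_cancel (volume_ball_ne_zero _ ht)
          (volume_ball_ne_top _ _), mul_one]
    _ ≤ _ := by gcongr; exact le_ballMax _ x ht

theorem volume_two_mul_lt_ballMax_le (hn : n ≠ 0) (h : EuclideanSpace ℝ (Fin n) → ℝ≥0∞)
    {s : ℝ≥0∞} (hs : s ≠ 0) (hst : s ≠ ∞) :
    volume {x | 2 * s < ballMax h x} ≤ s⁻¹ * (4 ^ n * ∫⁻ y, {y | s < h y}.indicator h y) := by
  rw [← ENNReal.div_eq_inv_mul, ENNReal.le_div_iff_mul_le (Or.inl hs) (Or.inl hst), mul_comm]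
  refine le_trans ?_ (mul_volume_lt_ballMax_le hn _ s hs)
  refine mul_le_mul' le_rfl (measure_mono fun x hx => ?_)
  have h1 : s + s < ballMax ({y | s < h y}.indicator h) x + s := by
    rw [← two_mul]
    exact lt_of_lt_of_le hx (ballMax_le_add x)
  exact lt_of_add_lt_add_right h1

/-- Pointwise form of the sum over levels `a ^ j`. Only levels below `v` count; at the `i`-th one
down, `∇₂` gives `(2a)^(-i)` while the weak type weight costs `a^(i+1)`. The geometric series sums
to `2`, so `2 * C * a ≤ m` suffices. -/
theorem tsum_levels_le (hΦ : IsStarShaped Φ) {a : ℝ≥0} (ha1 : 1 < a)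
    (ha : ∀ r : ℝ≥0, Φ r ≤ 1 / (2 * (a : ℝ≥0∞)) * Φ (a * r)) {C m : ℝ≥0} (hm1 : 1 ≤ m)
    (hm : 2 * C * a ≤ m) (v : ℝ≥0∞) :
    ∑' j : ℤ, Φ (a ^ j / m) * (((a ^ j : ℝ≥0) : ℝ≥0∞)⁻¹ *
      (C * {w : ℝ≥0∞ | ((a ^ j : ℝ≥0) : ℝ≥0∞) < w}.indicator id v)) ≤ extend Φ v := by
  have ha0 : 0 < a := zero_lt_one.trans ha1
  have hm0 : 0 < m := zero_lt_one.trans_le hm1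
  rcases eq_or_ne v ∞ with rfl | hv
  · rw [extend_top hΦ]; exact le_top
  lift v to ℝ≥0 using hv
  rcases eq_or_ne v 0 with rfl | hv0
  · simp
  obtain ⟨J, hJ1, hJ2⟩ := NNReal.exists_mem_Ioc_zpow hv0 ha1
  set F : ℤ → ℝ≥0∞ := fun j => Φ (a ^ j / m) * (((a ^ j : ℝ≥0) : ℝ≥0∞)⁻¹ *
      (C * {w : ℝ≥0∞ | ((a ^ j : ℝ≥0) : ℝ≥0∞) < w}.indicator id (v : ℝ≥0∞))) with hF
  have hinj : Function.Injective fun i : ℕ => J - (i : ℤ) := fun i k hik => by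
    have : J - (i : ℤ) = J - k := hik
    omega
  have hsupp : Function.support F ⊆ range fun i : ℕ => J - (i : ℤ) := by
    intro j hj
    by_cases hjv : a ^ j < v
    · have hlt : a ^ j < a ^ (J + 1) := hjv.trans_le hJ2
      have : j < J + 1 := (zpow_lt_zpow_iff_right₀ ha1).1 hlt
      exact ⟨(J - j).toNat, by simp only; omega⟩
    · exfalso
      apply hj
      simp [hF, hjv]
  rw [← hinj.tsum_eq hsupp]
  have hterm : ∀ i : ℕ, F (J - i) ≤ (C * a / m : ℝ≥0) * extend Φ v * (2⁻¹ : ℝ≥0∞) ^ i := by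
    intro i
    have h1 : Φ (a ^ (J - i : ℤ) / m) ≤
        (m⁻¹ : ℝ≥0) * ((2 * (a : ℝ≥0∞))⁻¹ ^ i * extend Φ v) := by
      rw [div_eq_inv_mul]
      refine (hΦ.star _ (inv_le_one_of_one_le₀ hm1) _).trans ?_
      gcongr
      refine (le_pow_mul_of_nabla ha i _).trans ?_
      gcongr
      refine le_extend (ENNReal.coe_le_coe.2 ?_)
      rw [← zpow_natCast, ← zpow_add₀ ha0.ne']
      convert hJ1.le using 2
      ring
    have h2 : ((a ^ (J - i : ℤ) : ℝ≥0) : ℝ≥0∞)⁻¹ *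
        (C * {w : ℝ≥0∞ | ((a ^ (J - i : ℤ) : ℝ≥0) : ℝ≥0∞) < w}.indicator id (v : ℝ≥0∞)) ≤
        (C * a ^ (i + 1) : ℝ≥0) := by
      calc _ ≤ ((a ^ (J - i : ℤ) : ℝ≥0) : ℝ≥0∞)⁻¹ * (C * (a ^ (J + 1) : ℝ≥0)) := by
            gcongr
            refine (indicator_le_self _ _ _).trans ?_
            exact ENNReal.coe_le_coe.2 hJ2
        _ = (C * a ^ (i + 1) : ℝ≥0) := by
            rw [← ENNReal.coe_inv (zpow_pos ha0 _).ne', ← ENNReal.coe_mul, ← ENNReal.coe_mul,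
              mul_left_comm, ← zpow_neg, ← zpow_add₀ ha0.ne', ← zpow_natCast]
            congr 3
            push_cast
            ring
    refine (mul_le_mul' h1 h2).trans (le_of_eq ?_)
    have h3 : (2 * (a : ℝ≥0∞))⁻¹ ^ i = 2⁻¹ ^ i * ((a⁻¹ ^ i : ℝ≥0) : ℝ≥0∞) := by
      rw [ENNReal.mul_inv (by simp) (by simp), mul_pow, ENNReal.coe_pow, ENNReal.coe_inv ha0.ne']
    have h4 : C * a / m = m⁻¹ * a⁻¹ ^ i * (C * a ^ (i + 1)) := by
      have : a⁻¹ ^ i * a ^ i = 1 := by rw [← mul_pow, inv_mul_cancel₀ ha0.ne', one_pow]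
      calc C * a / m = m⁻¹ * C * a * (a⁻¹ ^ i * a ^ i) := by rw [this, div_eq_inv_mul]; ring
        _ = _ := by ring
    rw [h3, h4]
    push_cast
    ring
  refine (ENNReal.tsum_le_tsum hterm).trans ?_
  rw [ENNReal.tsum_mul_left, ENNReal.tsum_geometric, ENNReal.one_sub_inv_two, inv_inv]
  calc ((C * a / m : ℝ≥0) : ℝ≥0∞) * extend Φ v * 2
      = ((2 * C * a / m : ℝ≥0) : ℝ≥0∞) * extend Φ v := by
        push_cast [ENNReal.coe_div hm0.ne']
        simp only [div_eq_mul_inv]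
        ring
    _ ≤ 1 * extend Φ v := by
        gcongr
        exact_mod_cast div_le_one_of_le₀ hm zero_le
    _ = extend Φ v := one_mul _

/-- The modular inequality for the maximal function. -/
theorem exists_lintegral_extend_ballMax_le (hn : n ≠ 0) (hΦ : IsStarShaped Φ)
    (hN : NablaTwo Φ) : ∃ A : ℝ≥0, 0 < A ∧
      ∀ h : EuclideanSpace ℝ (Fin n) → ℝ≥0∞, AEMeasurable h →
        ∫⁻ x, extend Φ (ballMax h x / A) ≤ ∫⁻ x, extend Φ (h x) := by
  obtain ⟨a, ha1, ha⟩ := hN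
  have ha0 : 0 < a := zero_lt_one.trans ha1
  set C : ℝ≥0 := 4 ^ n with hC
  set m : ℝ≥0 := max 1 (2 * C * a)
  have hm1 : 1 ≤ m := le_max_left _ _
  have hm0 : 0 < m := zero_lt_one.trans_le hm1
  -- The `2` comes from truncating at half the level, `a` from rounding to a power of `a`, and `m`
  -- makes the sum over levels at most `Φ(h)`.
  refine ⟨2 * a * m, by positivity, fun h hh => ?_⟩
  have hpt : ∀ x, extend Φ (ballMax h x / (2 * a * m : ℝ≥0)) ≤
      ∑' j : ℤ, {x | 2 * ((a ^ j : ℝ≥0) : ℝ≥0∞) < ballMax h x}.indicator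
        (fun _ => Φ (a ^ j / m)) x := by
    intro x
    refine iSup₂_le fun r hr => ?_
    rcases eq_or_ne r 0 with rfl | hr0
    · rw [hΦ.map_zero]; exact zero_le
    -- One term of the series suffices: `a ^ j < a * m * r ≤ a ^ (j + 1)` gives both `r ≤ a ^ j / m`
    -- and `2 * a ^ j < ballMax h x`.
    obtain ⟨j, hj1, hj2⟩ := NNReal.exists_mem_Ioc_zpow (x := a * m * r) (by positivity) ha1
    refine le_trans ?_ (ENNReal.le_tsum j)
    rw [indicator_of_mem]
    · refine hΦ.monotone ?_
      rw [le_div_iff₀ hm0]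
      rw [zpow_add_one₀ ha0.ne'] at hj2
      refine le_of_mul_le_mul_right ?_ ha0
      calc r * m * a = a * m * r := by ring
        _ ≤ _ := hj2
    · rw [ENNReal.le_div_iff_mul_le (Or.inl (by positivity)) (Or.inl ENNReal.coe_ne_top)] at hr
      refine lt_of_lt_of_le ?_ hr
      rw [← ENNReal.coe_ofNat, ← ENNReal.coe_mul, ← ENNReal.coe_mul, ENNReal.coe_lt_coe]
      calc 2 * a ^ j < 2 * (a * m * r) := by gcongr
        _ = r * (2 * a * m) := by ring
  have hmeas : ∀ j : ℤ, MeasurableSet {x | 2 * ((a ^ j : ℝ≥0) : ℝ≥0∞) < ballMax h x} := fun j =>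
    measurableSet_lt measurable_const (measurable_ballMax h)
  have hpow : ∀ j : ℤ, ((a ^ j : ℝ≥0) : ℝ≥0∞) ≠ 0 := fun j => by
    simpa using (zpow_pos ha0 j).ne'
  have hind : ∀ j : ℤ, Measurable
      ({w : ℝ≥0∞ | ((a ^ j : ℝ≥0) : ℝ≥0∞) < w}.indicator (id : ℝ≥0∞ → ℝ≥0∞)) := fun j =>
    measurable_id.indicator (measurableSet_lt measurable_const measurable_id)
  calc ∫⁻ x, extend Φ (ballMax h x / (2 * a * m : ℝ≥0))
      ≤ ∫⁻ x, ∑' j : ℤ, {x | 2 * ((a ^ j : ℝ≥0) : ℝ≥0∞) < ballMax h x}.indicator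
        (fun _ => Φ (a ^ j / m)) x := lintegral_mono hpt
    _ = ∑' j : ℤ, Φ (a ^ j / m) * volume {x | 2 * ((a ^ j : ℝ≥0) : ℝ≥0∞) < ballMax h x} := by
        rw [lintegral_tsum fun j => (measurable_const.indicator (hmeas j)).aemeasurable]
        exact tsum_congr fun j => lintegral_indicator_const (hmeas j) _
    _ ≤ ∑' j : ℤ, Φ (a ^ j / m) * (((a ^ j : ℝ≥0) : ℝ≥0∞)⁻¹ * (4 ^ n *
          ∫⁻ y, {y | ((a ^ j : ℝ≥0) : ℝ≥0∞) < h y}.indicator h y)) := by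
        gcongr with j
        exact volume_two_mul_lt_ballMax_le hn h (hpow j) ENNReal.coe_ne_top
    _ = ∑' j : ℤ, ∫⁻ y, Φ (a ^ j / m) * (((a ^ j : ℝ≥0) : ℝ≥0∞)⁻¹ *
          (C * {w : ℝ≥0∞ | ((a ^ j : ℝ≥0) : ℝ≥0∞) < w}.indicator id (h y))) := by
        refine tsum_congr fun j => ?_
        have hj : AEMeasurable fun y =>
            {w : ℝ≥0∞ | ((a ^ j : ℝ≥0) : ℝ≥0∞) < w}.indicator id (h y) :=
          (hind j).comp_aemeasurable hh
        rw [lintegral_const_mul'' _ ((hj.const_mul _).const_mul _),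
          lintegral_const_mul'' _ (hj.const_mul _), lintegral_const_mul'' _ hj, hC]
        push_cast
        rfl
    _ = ∫⁻ y, ∑' j : ℤ, Φ (a ^ j / m) * (((a ^ j : ℝ≥0) : ℝ≥0∞)⁻¹ *
          (C * {w : ℝ≥0∞ | ((a ^ j : ℝ≥0) : ℝ≥0∞) < w}.indicator id (h y))) := by
        rw [lintegral_tsum]
        exact fun j => ((((hind j).comp_aemeasurable hh).const_mul _).const_mul _).const_mul _
    _ ≤ ∫⁻ y, extend Φ (h y) :=
        lintegral_mono fun y => tsum_levels_le hΦ ha1 ha hm1 (le_max_right _ _) (h y)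

theorem ballMax_div (h : EuclideanSpace ℝ (Fin n) → ℝ≥0∞) {c : ℝ≥0∞} (hc : c ≠ 0)
    (x : EuclideanSpace ℝ (Fin n)) : ballMax (fun y => h y / c) x = ballMax h x / c := by
  simp only [ballMax, div_eq_mul_inv, ENNReal.iSup_mul]
  refine iSup_congr fun t => iSup_congr fun _ => ?_
  rw [lintegral_mul_const' _ _ (ENNReal.inv_ne_top.2 hc), mul_assoc]

theorem exists_luxNorm_ballMax_le (hn : n ≠ 0) (hΦ : IsStarShaped Φ) (hN : NablaTwo Φ) :
    ∃ A : ℝ≥0, ∀ h : EuclideanSpace ℝ (Fin n) → ℝ≥0∞, AEMeasurable h →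
      luxNorm Φ (ballMax h) ≤ A * luxNorm Φ h := by
  obtain ⟨A, hA0, hA⟩ := exists_lintegral_extend_ballMax_le hn hΦ hN
  have hA0' : (A : ℝ≥0∞) ≠ 0 := by simpa using hA0.ne'
  refine ⟨A, fun h hh => ?_⟩
  rw [← ENNReal.div_le_iff' hA0' ENNReal.coe_ne_top]
  refine le_iInf₂ fun c hc => ENNReal.div_le_of_le_mul' ?_
  have hc0 : (c : ℝ≥0∞) ≠ 0 := by simpa using hc.1.ne'
  rw [← ENNReal.coe_mul]
  refine luxNorm_le (mul_pos hA0 hc.1) (le_trans (le_of_eq ?_)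
    ((hA (fun y => h y / c) (hh.div_const _)).trans hc.2))
  refine lintegral_congr fun x => ?_
  rw [ballMax_div h hc0, ENNReal.coe_mul, div_eq_mul_inv, div_eq_mul_inv, div_eq_mul_inv,
    ENNReal.mul_inv (Or.inl hA0') (Or.inl ENNReal.coe_ne_top), mul_assoc, mul_comm (A : ℝ≥0∞)⁻¹]

/-! ### Orlicz–Morrey norms and the maximal operator on them -/

/-- The number `Φ⁻¹(|B|^{-p})`, for a ball `B` of radius `r`. -/
noncomputable def ballInv (n : ℕ) (Φ : ℝ≥0 → ℝ≥0∞) (p r : ℝ) : ℝ≥0∞ :=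
  youngInv Φ (volume (Metric.ball (0 : EuclideanSpace ℝ (Fin n)) r) ^ (-p))

/-- The Orlicz–Morrey quasinorm of a nonnegative extended-real-valued function. -/
noncomputable def morreyNorm (Φ : ℝ≥0 → ℝ≥0∞) (p : ℝ)
    (h : EuclideanSpace ℝ (Fin n) → ℝ≥0∞) : ℝ≥0∞ :=
  ⨆ (x : EuclideanSpace ℝ (Fin n)) (r : ℝ) (_ : 0 < r),
    ballInv n Φ p r * luxNorm Φ ((Metric.ball x r).indicator h)

/-- The ratio `Φ⁻¹(|B|^{-1}) / Φ⁻¹(|B|^{-p})`, for a ball `B` of radius `r`. -/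
noncomputable def ballRatio (n : ℕ) (Φ : ℝ≥0 → ℝ≥0∞) (p r : ℝ) : ℝ≥0∞ :=
  ballInv n Φ 1 r / ballInv n Φ p r

theorem volume_rpow_ne_zero (x : EuclideanSpace ℝ (Fin n)) {r : ℝ} (hr : 0 < r) (p : ℝ) :
    volume (Metric.ball x r) ^ p ≠ 0 :=
  (ENNReal.rpow_pos (Metric.measure_ball_pos _ _ hr) (volume_ball_ne_top _ _)).ne'

theorem volume_rpow_ne_top (x : EuclideanSpace ℝ (Fin n)) {r : ℝ} (hr : 0 < r) (p : ℝ) :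
    volume (Metric.ball x r) ^ p ≠ ∞ :=
  ENNReal.rpow_ne_top_of_ne_zero (volume_ball_ne_zero _ hr) (volume_ball_ne_top _ _)

theorem ballInv_ne_zero (hΦ : IsStarShaped Φ) (p : ℝ) {r : ℝ} (hr : 0 < r) :
    ballInv n Φ p r ≠ 0 :=
  youngInv_ne_zero hΦ (volume_rpow_ne_zero _ hr _)

theorem ballInv_ne_top (hΦ : IsStarShaped Φ) (p : ℝ) {r : ℝ} (hr : 0 < r) :
    ballInv n Φ p r ≠ ∞ :=
  youngInv_ne_top hΦ (volume_rpow_ne_top _ hr _)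

theorem ballRatio_ne_zero (hΦ : IsStarShaped Φ) (p : ℝ) {r : ℝ} (hr : 0 < r) :
    ballRatio n Φ p r ≠ 0 :=
  ENNReal.div_ne_zero.2 ⟨ballInv_ne_zero hΦ 1 hr, ballInv_ne_top hΦ p hr⟩

theorem ballRatio_ne_top (hΦ : IsStarShaped Φ) (p : ℝ) {r : ℝ} (hr : 0 < r) :
    ballRatio n Φ p r ≠ ∞ :=
  ENNReal.div_ne_top (ballInv_ne_top hΦ 1 hr) (ballInv_ne_zero hΦ p hr)

theorem ballInv_one (x : EuclideanSpace ℝ (Fin n)) {r : ℝ} (hr : 0 < r) :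
    ballInv n Φ 1 r = youngInv Φ (volume (Metric.ball x r))⁻¹ := by
  rw [ballInv, ENNReal.rpow_neg_one, volume_ball_center 0 x hr]

theorem ballInv_comp_rpow {β : ℝ} (hβ : 0 < β) (p r : ℝ) :
    ballInv n (fun t => Φ (t ^ (1 / β))) p r = ballInv n Φ p r ^ β :=
  youngInv_rpow hβ _

theorem ballInv_anti {p : ℝ} (hp : 0 ≤ p) {r s : ℝ} (hrs : r ≤ s) :
    ballInv n Φ p s ≤ ballInv n Φ p r := by
  refine youngInv_mono ?_
  rw [ENNReal.rpow_neg, ENNReal.rpow_neg]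
  gcongr

theorem ballInv_le_two_mul (hΦ : IsStarShaped Φ) {p : ℝ} (hp : 0 ≤ p) (hp1 : p ≤ 1) {r : ℝ}
    (hr : 0 < r) : ballInv n Φ p r ≤ 2 ^ n * ballInv n Φ p (2 * r) := by
  have h1 : (1 : ℝ≥0) ≤ 2 ^ n := one_le_pow₀ one_le_two
  have h := youngInv_mul_le hΦ h1
    (volume (Metric.ball (0 : EuclideanSpace ℝ (Fin n)) (2 * r)) ^ (-p))
  push_cast at h
  refine (youngInv_mono ?_).trans h
  have hE : (1 : ℝ≥0∞) ≤ 2 ^ n := one_le_pow₀ one_le_two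
  have h0 : ((2 : ℝ≥0∞) ^ n) ^ p ≠ 0 := by simp [ENNReal.rpow_eq_zero_iff]
  have ht : ((2 : ℝ≥0∞) ^ n) ^ p ≠ ∞ := ENNReal.rpow_ne_top_of_nonneg hp (by simp)
  rw [volume_ball_mul 0 0 hr two_pos, ENNReal.ofReal_ofNat,
    ENNReal.mul_rpow_of_ne_top (by simp) (volume_ball_ne_top _ _), ENNReal.rpow_neg (2 ^ n),
    ← mul_assoc]
  refine le_mul_of_one_le_left' ?_
  rw [← ENNReal.mul_inv_cancel h0 ht]
  gcongr
  simpa using ENNReal.rpow_le_rpow_of_exponent_le hE hp1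

theorem exists_youngInv_mul_comparable (hΦ : IsStarShaped Φ) {c : ℝ≥0∞} (h0 : c ≠ 0)
    (ht : c ≠ ∞) : ∃ k : ℝ≥0, 1 ≤ k ∧ ∀ s, youngInv Φ (c * s) ≤ k * youngInv Φ s ∧
      youngInv Φ s ≤ k * youngInv Φ (c * s) := by
  lift c to ℝ≥0 using ht
  have h0' : c ≠ 0 := by simpa using h0
  have hk : 1 ≤ max 1 (max c c⁻¹) := le_max_left _ _
  refine ⟨max 1 (max c c⁻¹), hk, fun s => ⟨?_, ?_⟩⟩
  · refine (youngInv_mono ?_).trans (youngInv_mul_le hΦ hk s)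
    gcongr
    exact (le_max_left _ _).trans (le_max_right _ _)
  · refine (youngInv_mono ?_).trans (youngInv_mul_le hΦ hk _)
    calc s = (c⁻¹ : ℝ≥0) * (c * s) := by
          rw [← mul_assoc, ENNReal.coe_inv h0', ENNReal.inv_mul_cancel h0 ENNReal.coe_ne_top,
            one_mul]
      _ ≤ _ := by
          gcongr
          exact (le_max_right _ _).trans (le_max_right _ _)

theorem exists_ballInv_comparable (hΦ : IsStarShaped Φ) (p : ℝ) :
    ∃ k : ℝ≥0, 1 ≤ k ∧ ∀ t : ℝ≥0, 0 < t →
      ballInv n Φ p t ≤ k * youngInv Φ ((t : ℝ≥0∞) ^ (-(n * p))) ∧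
      youngInv Φ ((t : ℝ≥0∞) ^ (-(n * p))) ≤ k * ballInv n Φ p t := by
  obtain ⟨k, hk1, hk⟩ := exists_youngInv_mul_comparable hΦ
    (volume_rpow_ne_zero (0 : EuclideanSpace ℝ (Fin n)) one_pos (-p))
    (volume_rpow_ne_top (0 : EuclideanSpace ℝ (Fin n)) one_pos (-p))
  refine ⟨k, hk1, fun t ht => ?_⟩
  have h := hk ((t : ℝ≥0∞) ^ (-(n * p)))
  have hv : volume (Metric.ball (0 : EuclideanSpace ℝ (Fin n)) t) ^ (-p) =
      volume (Metric.ball (0 : EuclideanSpace ℝ (Fin n)) 1) ^ (-p) * (t : ℝ≥0∞) ^ (-(n * p)) := by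
    rw [volume_ball_eq 0 (NNReal.coe_pos.2 ht), ENNReal.ofReal_coe_nnreal,
      ENNReal.mul_rpow_of_ne_top (by simp) (volume_ball_ne_top _ _), mul_comm,
      ← ENNReal.rpow_natCast, ← ENNReal.rpow_mul, mul_neg]
  rwa [← hv] at h

/-- Passing from `t ^ n` to `|B|` only inserts powers of the unit ball's volume, which the doubling
of `Φ⁻¹` absorbs. -/
theorem exists_ballRatio_comparable (hn : n ≠ 0) (hΦ : IsStarShaped Φ) (lam : ℝ) :
    ∃ k : ℝ≥0, 1 ≤ k ∧ ∀ t : ℝ≥0, 0 < t →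
      ballRatio n Φ (lam / n) t ≤ k * invRatio n lam Φ t ∧
      invRatio n lam Φ t ≤ k * ballRatio n Φ (lam / n) t := by
  obtain ⟨k₁, hk₁, h₁⟩ := exists_ballInv_comparable (n := n) hΦ 1
  obtain ⟨k₂, hk₂, h₂⟩ := exists_ballInv_comparable (n := n) hΦ (lam / n)
  rw [mul_div_cancel₀ _ (by exact_mod_cast hn : (n : ℝ) ≠ 0)] at h₂
  rw [mul_one] at h₁
  have hdiv : ∀ {a b c d : ℝ≥0∞}, a ≤ k₁ * b → c ≤ k₂ * d →
      a / d ≤ (k₁ * k₂ : ℝ≥0) * (b / c) := by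
    intro a b c d hab hcd
    have hk0 : (k₂ : ℝ≥0∞) ≠ 0 := by simpa using (zero_lt_one.trans_le hk₂).ne'
    calc a / d ≤ k₁ * b / d := ENNReal.div_le_div_right hab _
      _ = k₁ * k₂ * b / (k₂ * d) := by
        rw [mul_comm (k₁ : ℝ≥0∞) k₂, mul_assoc (k₂ : ℝ≥0∞),
          ENNReal.mul_div_mul_left _ _ hk0 ENNReal.coe_ne_top]
      _ ≤ k₁ * k₂ * b / c := ENNReal.div_le_div_left hcd _
      _ = _ := by rw [mul_div_assoc, ENNReal.coe_mul]
  refine ⟨k₁ * k₂, one_le_mul hk₁ hk₂, fun t ht => ⟨?_, ?_⟩⟩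
  · exact hdiv (h₁ t ht).1 (h₂ t ht).2
  · exact hdiv (h₁ t ht).2 (h₂ t ht).1

theorem ballInv_mul_luxNorm_le (p : ℝ) (h : EuclideanSpace ℝ (Fin n) → ℝ≥0∞)
    (x : EuclideanSpace ℝ (Fin n)) {r : ℝ} (hr : 0 < r) :
    ballInv n Φ p r * luxNorm Φ ((Metric.ball x r).indicator h) ≤ morreyNorm Φ p h := by
  unfold morreyNorm
  exact le_iSup_of_le x (le_iSup₂_of_le r hr le_rfl)

theorem luxNorm_indicator_le_div (hΦ : IsStarShaped Φ) (p : ℝ)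
    (h : EuclideanSpace ℝ (Fin n) → ℝ≥0∞) (x : EuclideanSpace ℝ (Fin n)) {r : ℝ} (hr : 0 < r) :
    luxNorm Φ ((Metric.ball x r).indicator h) ≤ morreyNorm Φ p h / ballInv n Φ p r := by
  rw [ENNReal.le_div_iff_mul_le (Or.inl (ballInv_ne_zero hΦ p hr))
    (Or.inl (ballInv_ne_top hΦ p hr)), mul_comm]
  exact ballInv_mul_luxNorm_le p h x hr

theorem luxNorm_indicator_ball_le (hΦ : IsStarShaped Φ) (x : EuclideanSpace ℝ (Fin n)) {r : ℝ}
    (hr : 0 < r) :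
    luxNorm Φ ((Metric.ball x r).indicator fun _ => 1) ≤ (ballInv n Φ 1 r)⁻¹ := by
  rw [ballInv_one x hr]
  exact luxNorm_indicator_one_le hΦ measurableSet_ball (volume_ball_ne_zero _ hr)
    (volume_ball_ne_top _ _)

theorem morreyNorm_mono {p : ℝ} {h₁ h₂ : EuclideanSpace ℝ (Fin n) → ℝ≥0∞}
    (hle : ∀ x, h₁ x ≤ h₂ x) : morreyNorm Φ p h₁ ≤ morreyNorm Φ p h₂ := by
  unfold morreyNorm
  gcongr with x r hr
  exact luxNorm_mono (Eventually.of_forall fun y => indicator_le_indicator (hle y))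

/-- Hölder's inequality on one ball, with the Luxemburg norm there bounded through the Morrey norm.
-/
theorem average_le_ballRatio_mul (hΦ : IsStarShaped Φ) (p : ℝ)
    (h : EuclideanSpace ℝ (Fin n) → ℝ≥0∞) (x : EuclideanSpace ℝ (Fin n)) {r : ℝ} (hr : 0 < r) :
    (volume (Metric.ball x r))⁻¹ * ∫⁻ y in Metric.ball x r, h y ≤
      2 * ballRatio n Φ p r * morreyNorm Φ p h := by
  have hv0 := volume_ball_ne_zero x hr
  have hvt := volume_ball_ne_top x r
  calc (volume (Metric.ball x r))⁻¹ * ∫⁻ y in Metric.ball x r, h y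
      ≤ (volume (Metric.ball x r))⁻¹ * (2 * volume (Metric.ball x r) * ballInv n Φ 1 r *
          (morreyNorm Φ p h / ballInv n Φ p r)) := by
        gcongr
        refine (setLIntegral_le_luxNorm hΦ measurableSet_ball hv0 hvt).trans ?_
        rw [ballInv_one x hr]
        gcongr
        exact luxNorm_indicator_le_div hΦ p h x hr
    _ = (volume (Metric.ball x r))⁻¹ * volume (Metric.ball x r) *
          (2 * ballRatio n Φ p r * morreyNorm Φ p h) := by
        simp only [ballRatio, div_eq_mul_inv]
        ring
    _ = _ := by rw [ENNReal.inv_mul_cancel hv0 hvt, one_mul]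

theorem setLIntegral_ball_lt_top (hΦ : IsStarShaped Φ) {p : ℝ}
    {h : EuclideanSpace ℝ (Fin n) → ℝ≥0∞} (hK : morreyNorm Φ p h ≠ ∞)
    (x : EuclideanSpace ℝ (Fin n)) {r : ℝ} (hr : 0 < r) :
    ∫⁻ y in Metric.ball x r, h y < ∞ := by
  have h1 := average_le_ballRatio_mul hΦ p h x hr
  rw [← ENNReal.div_eq_inv_mul,
    ENNReal.div_le_iff (volume_ball_ne_zero _ hr) (volume_ball_ne_top _ _)] at h1
  refine h1.trans_lt (ENNReal.mul_lt_top (Ne.lt_top ?_) (volume_ball_ne_top _ _).lt_top)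
  exact ENNReal.mul_ne_top (ENNReal.mul_ne_top (by simp) (ballRatio_ne_top hΦ p hr)) hK

/-- Boundedness of the maximal operator on Orlicz–Morrey spaces. -/
theorem exists_morreyNorm_ballMax_le (hn : n ≠ 0) (hΦ : IsStarShaped Φ) (hN : NablaTwo Φ) {p : ℝ}
    (hp : 0 ≤ p) (hp1 : p ≤ 1) {D : ℝ≥0}
    (hD : ∀ r s : ℝ, 0 < r → r ≤ s → ballRatio n Φ p s ≤ D * ballRatio n Φ p r) :
    ∃ C : ℝ≥0, ∀ h : EuclideanSpace ℝ (Fin n) → ℝ≥0∞, AEMeasurable h → morreyNorm Φ p h ≠ ∞ →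
      morreyNorm Φ p (ballMax h) ≤ C * morreyNorm Φ p h := by
  obtain ⟨A, hA⟩ := exists_luxNorm_ballMax_le hn hΦ hN
  refine ⟨2 * max (2 ^ n * A) (2 * D), fun h hh hK => iSup_le fun x => iSup₂_le fun r hr => ?_⟩
  set K := morreyNorm Φ p h
  set B := Metric.ball x r
  set B₂ := Metric.ball x (2 * r)
  set W := ballInv n Φ p r
  set U := ballInv n Φ 1 r
  have hW0 : W ≠ 0 := ballInv_ne_zero hΦ p hr
  have hWt : W ≠ ∞ := ballInv_ne_top hΦ p hr
  have hU0 : U ≠ 0 := ballInv_ne_zero hΦ 1 hr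
  have hUt : U ≠ ∞ := ballInv_ne_top hΦ 1 hr
  set a := 2 * (D * ballRatio n Φ p r) * K with ha
  have hat : a ≠ ∞ := ENNReal.mul_ne_top (ENNReal.mul_ne_top (by simp)
    (ENNReal.mul_ne_top ENNReal.coe_ne_top (ballRatio_ne_top hΦ p hr))) hK
  -- For `z ∈ B`, balls of radius below `r` stay inside `B₂`, while averages over larger radii are
  -- at most `2 ρ(t) K ≤ 2 D ρ(r) K = a`.
  have hpt : ∀ z, B.indicator (ballMax h) z ≤
      max (ballMax (B₂.indicator h) z) (a * B.indicator (fun _ => 1) z) := by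
    intro z
    by_cases hz : z ∈ B
    swap
    · simp [hz]
    rw [indicator_of_mem hz, indicator_of_mem hz, mul_one]
    refine iSup₂_le fun t ht => ?_
    rcases lt_or_ge t r with htr | htr
    · refine le_trans ?_ ((le_ballMax (B₂.indicator h) z ht).trans (le_max_left _ _))
      gcongr 1
      refine setLIntegral_mono' measurableSet_ball fun y hy => ?_
      rw [indicator_of_mem]
      have hy' : dist y z < t := hy
      have hz' : dist z x < r := hz
      have := dist_triangle y z x
      show dist y x < 2 * r
      linarith
    · refine le_trans ?_ (le_max_right _ _)
      refine (average_le_ballRatio_mul hΦ p h z ht).trans ?_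
      rw [ha]
      gcongr
      exact hD r t hr htr
  calc W * luxNorm Φ (B.indicator (ballMax h))
      ≤ W * (2 * max (luxNorm Φ (ballMax (B₂.indicator h)))
          (luxNorm Φ fun z => a * B.indicator (fun _ => 1) z)) := by
        gcongr
        exact luxNorm_le_two_mul_max hΦ (measurable_ballMax _).aemeasurable
          (Eventually.of_forall hpt)
    _ = 2 * max (W * luxNorm Φ (ballMax (B₂.indicator h)))
          (W * luxNorm Φ fun z => a * B.indicator (fun _ => 1) z) := by
        rw [← mul_max, mul_left_comm]
    _ ≤ 2 * max (2 ^ n * A * K) (2 * D * K) := by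
        gcongr 2
        · calc W * luxNorm Φ (ballMax (B₂.indicator h))
              ≤ (2 ^ n * ballInv n Φ p (2 * r)) * (A * luxNorm Φ (B₂.indicator h)) := by
                gcongr
                · exact ballInv_le_two_mul hΦ hp hp1 hr
                · exact hA _ (hh.indicator measurableSet_ball)
            _ = 2 ^ n * A * (ballInv n Φ p (2 * r) * luxNorm Φ (B₂.indicator h)) := by ring
            _ ≤ 2 ^ n * A * K := by
                gcongr
                exact ballInv_mul_luxNorm_le p h x (by positivity)
        · calc W * luxNorm Φ (fun z => a * B.indicator (fun _ => 1) z)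
              ≤ W * (a * U⁻¹) := by
                gcongr
                refine (luxNorm_const_mul_le hΦ hat).trans ?_
                gcongr
                exact luxNorm_indicator_ball_le hΦ x hr
            -- The constant `a` carries the factor `ρ(r) = U / W`, which cancels the weight `W` and
            -- the norm `U⁻¹` of the indicator.
            _ = (W * W⁻¹) * (U * U⁻¹) * (2 * D * K) := by
                rw [ha, ballRatio, div_eq_mul_inv]
                ring
            _ = 2 * D * K := by
                rw [ENNReal.mul_inv_cancel hW0 hWt, ENNReal.mul_inv_cancel hU0 hUt, one_mul,
                  one_mul]
    _ = _ := by
        push_cast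
        rw [← max_mul, mul_assoc]

theorem orliczMorreyNorm_eq_morreyNorm (hΦ : IsStarShaped Φ) (lam : ℝ)
    (f : EuclideanSpace ℝ (Fin n) → ℝ) :
    orliczMorreyNorm Φ lam f = morreyNorm Φ (lam / n) fun x => ‖f x‖ₑ := by
  unfold orliczMorreyNorm morreyNorm
  refine iSup_congr fun x => iSup_congr fun r => iSup_congr fun hr => ?_
  rw [ballInv, volume_ball_center 0 x hr, orliczNorm_eq_luxNorm hΦ]
  simp only [enorm_indicator_eq_indicator_enorm]

theorem memOrliczMorrey_of_morreyNorm_ne_top (hΦ : IsStarShaped Φ) {lam : ℝ}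
    {f : EuclideanSpace ℝ (Fin n) → ℝ} (hf : Measurable f)
    (hK : morreyNorm Φ (lam / n) (fun x => ‖f x‖ₑ) ≠ ∞) : MemOrliczMorrey Φ lam f := by
  refine ⟨fun x r hr => ⟨?_, ?_⟩, ?_⟩
  · refine Integrable.locallyIntegrable ((integrable_indicator_iff measurableSet_ball).2 ?_)
    exact ⟨hf.aestronglyMeasurable, setLIntegral_ball_lt_top hΦ hK x hr⟩
  · have h1 : luxNorm Φ ((Metric.ball x r).indicator fun x => ‖f x‖ₑ) ≠ ∞ :=
      ((luxNorm_indicator_le_div hΦ _ _ x hr).trans_lt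
        (ENNReal.div_lt_top hK (ballInv_ne_zero hΦ _ hr))).ne
    obtain ⟨c, hc⟩ := ENNReal.lt_iff_exists_nnreal_btwn.1 h1.lt_top
    have hc0 : 0 < c := by simpa using zero_le.trans_lt hc.1
    refine ⟨c⁻¹, inv_pos.2 hc0, lt_of_le_of_lt (le_of_eq ?_)
      ((lintegral_le_one_of_luxNorm_lt hc.1).trans_lt ENNReal.one_lt_top)⟩
    refine lintegral_congr fun y => ?_
    rw [← enorm_indicator_eq_indicator_enorm, enorm_eq_nnnorm, ← ENNReal.coe_div hc0.ne',
      extend_coe hΦ, div_eq_inv_mul]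
  · rw [orliczMorreyNorm_eq_morreyNorm hΦ]
    exact hK.lt_top

theorem MemOrliczLoc.aestronglyMeasurable {f : EuclideanSpace ℝ (Fin n) → ℝ}
    (hf : MemOrliczLoc Φ f) : AEStronglyMeasurable f volume := by
  have hU : (⋃ k : ℕ, Metric.ball (0 : EuclideanSpace ℝ (Fin n)) (k + 1)) = univ := by
    refine eq_univ_of_forall fun x => mem_iUnion.2 ?_
    obtain ⟨k, hk⟩ := exists_nat_gt (dist x 0)
    exact ⟨k, by rw [Metric.mem_ball]; linarith⟩
  rw [← Measure.restrict_univ (μ := (volume : Measure (EuclideanSpace ℝ (Fin n)))), ← hU,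
    aestronglyMeasurable_iUnion_iff]
  intro k
  exact (aestronglyMeasurable_indicator_iff measurableSet_ball).1
    (hf 0 (k + 1) (by positivity)).1.aestronglyMeasurable

theorem ae_lt_top_of_forall_ball {h : EuclideanSpace ℝ (Fin n) → ℝ≥0∞} (hm : Measurable h)
    (hfin : ∀ r : ℝ, 0 < r → ∫⁻ y in Metric.ball 0 r, h y < ∞) : ∀ᵐ x, h x < ∞ := by
  have h1 : ∀ k : ℕ, ∀ᵐ x, x ∈ Metric.ball (0 : EuclideanSpace ℝ (Fin n)) (k + 1) → h x < ∞ :=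
    fun k => (ae_restrict_iff' measurableSet_ball).1
      (ae_lt_top hm (hfin (k + 1) (by positivity)).ne)
  filter_upwards [ae_all_iff.2 h1] with x hx
  obtain ⟨k, hk⟩ := exists_nat_gt (dist x 0)
  exact hx k (by rw [Metric.mem_ball]; linarith)

/-! ### Sufficiency -/

theorem rpow_mul_rpow_one_sub {β : ℝ} (hβ : 0 < β) (hβ1 : β < 1) (x : ℝ≥0∞) :
    x ^ β * x ^ (1 - β) = x := by
  rw [← ENNReal.rpow_add_of_nonneg _ _ hβ.le (sub_nonneg.2 hβ1.le), add_sub_cancel,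
    ENNReal.rpow_one]

theorem rpow_neg_le_of_le_mul {a b k : ℝ≥0∞} {q : ℝ} (hq : 0 ≤ q) (hk : k ≠ 0) (hkt : k ≠ ∞)
    (h : a ≤ k * b) : b ^ (-q) ≤ k ^ q * a ^ (-q) := by
  have h0 : k ^ q ≠ 0 := by simp [ENNReal.rpow_eq_zero_iff, hk, hkt]
  have ht : k ^ q ≠ ∞ := ENNReal.rpow_ne_top_of_nonneg hq hkt
  rw [ENNReal.rpow_neg, ENNReal.rpow_neg]
  calc (b ^ q)⁻¹ = k ^ q * (k ^ q * b ^ q)⁻¹ := by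
        rw [ENNReal.mul_inv (Or.inl h0) (Or.inl ht), ← mul_assoc, ENNReal.mul_inv_cancel h0 ht,
          one_mul]
    _ ≤ k ^ q * (a ^ q)⁻¹ := by
        gcongr
        rw [← ENNReal.mul_rpow_of_nonneg _ _ hq]
        gcongr

/-- The pointwise estimate of the fractional maximal function by the maximal function. -/
theorem exists_fracMaximal_le (hn : n ≠ 0) (hΦ : IsStarShaped Φ) {α β p : ℝ}
    (hβ : 0 < β) (hβ1 : β < 1) {C : ℝ≥0}
    (hC : ∀ t : ℝ≥0, 0 < t → (t : ℝ≥0∞) ^ α ≤ C * ballRatio n Φ p t ^ (β - 1)) :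
    ∃ C' : ℝ≥0, ∀ (f : EuclideanSpace ℝ (Fin n) → ℝ) (x : EuclideanSpace ℝ (Fin n)),
      fracMaximal α f x ≤ C' * morreyNorm Φ p (fun x => ‖f x‖ₑ) ^ (1 - β) *
        ballMax (fun x => ‖f x‖ₑ) x ^ β := by
  have hn' : (n : ℝ) ≠ 0 := by exact_mod_cast hn
  set b := volume (Metric.ball (0 : EuclideanSpace ℝ (Fin n)) 1)
  have hb : b ^ (α / n) ≠ ∞ := volume_rpow_ne_top _ one_pos _
  refine ⟨(b ^ (α / n)).toNNReal * C * 2 ^ (1 - β), fun f x => iSup₂_le fun t ht => ?_⟩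
  rw [ENNReal.coe_mul, ENNReal.coe_mul, ENNReal.coe_toNNReal hb,
    ENNReal.coe_rpow_of_nonneg _ (sub_nonneg.2 hβ1.le), ENNReal.coe_ofNat]
  set K := morreyNorm Φ p fun x => ‖f x‖ₑ
  set M := ballMax (fun x => ‖f x‖ₑ) x
  set ρ := ballRatio n Φ p t
  have hρ0 : ρ ≠ 0 := ballRatio_ne_zero hΦ p ht
  have hρt : ρ ≠ ∞ := ballRatio_ne_top hΦ p ht
  set avg := (volume (Metric.ball x t))⁻¹ * ∫⁻ y in Metric.ball x t, ‖f y‖ₑ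
  have hvol : volume (Metric.ball x t) ^ (α / n) = b ^ (α / n) * ENNReal.ofReal t ^ α := by
    rw [volume_ball_eq x ht, ENNReal.mul_rpow_of_ne_top (by simp) (volume_ball_ne_top _ _),
      ← ENNReal.rpow_natCast, ← ENNReal.rpow_mul, mul_div_cancel₀ _ hn', mul_comm]
  calc volume (Metric.ball x t) ^ (-1 + α / n) * ∫⁻ y in Metric.ball x t, ‖f y‖ₑ
      = b ^ (α / n) * ENNReal.ofReal t ^ α * avg := by
        rw [ENNReal.rpow_add _ _ (volume_ball_ne_zero _ ht) (volume_ball_ne_top _ _),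
          ENNReal.rpow_neg_one, hvol]
        ring
    -- Hedberg's splitting: the power `β` goes to the maximal function, the power `1 - β` to the
    -- Morrey norm.
    _ = b ^ (α / n) * ENNReal.ofReal t ^ α * (avg ^ β * avg ^ (1 - β)) := by
        rw [rpow_mul_rpow_one_sub hβ hβ1]
    _ ≤ b ^ (α / n) * (C * ρ ^ (β - 1)) * (M ^ β * (2 * ρ * K) ^ (1 - β)) := by
        have h1β : 0 ≤ 1 - β := sub_nonneg.2 hβ1.le
        gcongr
        · have := hC t.toNNReal (Real.toNNReal_pos.2 ht)
          rwa [Real.coe_toNNReal t ht.le] at this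
        · exact le_ballMax _ x ht
        · exact average_le_ballRatio_mul hΦ p _ x ht
    _ = b ^ (α / n) * C * 2 ^ (1 - β) * K ^ (1 - β) * M ^ β * (ρ ^ (β - 1) * ρ ^ (1 - β)) := by
        rw [ENNReal.mul_rpow_of_nonneg _ _ (sub_nonneg.2 hβ1.le),
          ENNReal.mul_rpow_of_nonneg _ _ (sub_nonneg.2 hβ1.le)]
        ring
    _ = _ := by
        rw [← ENNReal.rpow_add _ _ hρ0 hρt, show β - 1 + (1 - β) = 0 by ring, ENNReal.rpow_zero,
          mul_one]

/-- Both factors of the Morrey norm scale: `Ψ⁻¹ = (Φ⁻¹) ^ β`, and the Luxemburg norm of `h ^ β` is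
bounded by a `β`-th power. -/
theorem morreyNorm_comp_rpow_le (hΦ : IsStarShaped Φ) {β p : ℝ} (hβ : 0 < β) (hβ1 : β < 1)
    {a : ℝ≥0∞} (ha : a ≠ ∞) {g h : EuclideanSpace ℝ (Fin n) → ℝ≥0∞}
    (hgh : ∀ x, g x ≤ a * h x ^ β) :
    morreyNorm (fun t => Φ (t ^ (1 / β))) p g ≤ a * morreyNorm Φ p h ^ β := by
  have hΨ := hΦ.comp_rpow (p := 1 / β) ((one_le_div hβ).2 hβ1.le)
  refine iSup_le fun x => iSup₂_le fun r hr => ?_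
  rw [ballInv_comp_rpow hβ]
  set B := Metric.ball x r
  calc ballInv n Φ p r ^ β * luxNorm (fun t => Φ (t ^ (1 / β))) (B.indicator g)
      ≤ ballInv n Φ p r ^ β * (a * luxNorm Φ (B.indicator h) ^ β) := by
        gcongr
        calc _ ≤ luxNorm (fun t => Φ (t ^ (1 / β))) fun y => a * B.indicator h y ^ β := by
              refine luxNorm_mono (Eventually.of_forall fun y => ?_)
              by_cases hy : y ∈ B
              · simpa [hy] using hgh y
              · simp [hy]
          _ ≤ _ := luxNorm_const_mul_le hΨ ha
          _ ≤ _ := by gcongr; exact luxNorm_rpow_le hβ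
    _ = a * (ballInv n Φ p r * luxNorm Φ (B.indicator h)) ^ β := by
        rw [ENNReal.mul_rpow_of_nonneg _ _ hβ.le, mul_left_comm]
    _ ≤ _ := by gcongr; exact ballInv_mul_luxNorm_le p h x hr

theorem fracMaximalBounded_of_rpow_le (hn : n ≠ 0) (hΦ : IsStarShaped Φ) (hN : NablaTwo Φ)
    {α β lam : ℝ} (hβ : 0 < β) (hβ1 : β < 1) (hlam : 0 ≤ lam) (hlamn : lam ≤ n) {D : ℝ≥0}
    (hD : ∀ r s : ℝ, 0 < r → r ≤ s →
      ballRatio n Φ (lam / n) s ≤ D * ballRatio n Φ (lam / n) r)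
    {C : ℝ≥0}
    (hC : ∀ t : ℝ≥0, 0 < t → (t : ℝ≥0∞) ^ α ≤ C * ballRatio n Φ (lam / n) t ^ (β - 1)) :
    FracMaximalBounded n α lam Φ fun t => Φ (t ^ (1 / β)) := by
  have hΨ := hΦ.comp_rpow (p := 1 / β) ((one_le_div hβ).2 hβ1.le)
  have h1β : 0 ≤ 1 - β := sub_nonneg.2 hβ1.le
  obtain ⟨C₁, hC₁⟩ := exists_morreyNorm_ballMax_le hn hΦ hN (p := lam / n) (by positivity)
    (div_le_one_of_le₀ hlamn (by positivity)) hD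
  obtain ⟨C₂, hC₂⟩ := exists_fracMaximal_le hn hΦ hβ hβ1 hC
  refine ⟨C₂ * C₁ ^ β, fun f hf => ?_⟩
  have hfm := hf.1.aestronglyMeasurable
  have hK := hf.2
  rw [orliczMorreyNorm_eq_morreyNorm hΦ] at hK ⊢
  rw [orliczMorreyNorm_eq_morreyNorm hΨ]
  set K := morreyNorm Φ (lam / n) fun x => ‖f x‖ₑ
  have hg : morreyNorm (fun t => Φ (t ^ (1 / β))) (lam / n) (fracMaximal α f) ≤
      (C₂ * C₁ ^ β : ℝ≥0) * K := by
    calc _ ≤ C₂ * K ^ (1 - β) * (C₁ * K) ^ β := by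
          refine (morreyNorm_comp_rpow_le hΦ hβ hβ1 (ENNReal.mul_ne_top ENNReal.coe_ne_top
            (ENNReal.rpow_ne_top_of_nonneg h1β hK.ne)) (hC₂ f)).trans ?_
          gcongr
          exact hC₁ _ hfm.enorm hK.ne
      _ = C₂ * C₁ ^ β * (K ^ β * K ^ (1 - β)) := by
          rw [ENNReal.mul_rpow_of_nonneg _ _ hβ.le]
          ring
      _ = _ := by
          rw [rpow_mul_rpow_one_sub hβ hβ1, ENNReal.coe_mul,
            ENNReal.coe_rpow_of_nonneg _ hβ.le]
  have hgt : morreyNorm (fun t => Φ (t ^ (1 / β))) (lam / n) (fracMaximal α f) ≠ ∞ :=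
    (hg.trans_lt (ENNReal.mul_lt_top ENNReal.coe_lt_top hK)).ne
  -- `toReal` sends `∞` to `0`, so it can only lower the norm.
  have hle : morreyNorm (fun t => Φ (t ^ (1 / β))) (lam / n)
      (fun x => ‖(fracMaximal α f x).toReal‖ₑ) ≤
      morreyNorm (fun t => Φ (t ^ (1 / β))) (lam / n) (fracMaximal α f) :=
    morreyNorm_mono fun x => by
      rw [Real.enorm_eq_ofReal ENNReal.toReal_nonneg]
      exact ENNReal.ofReal_toReal_le
  have hgm := measurable_fracMaximal α f
  exact ⟨ae_lt_top_of_forall_ball hgm fun r hr => setLIntegral_ball_lt_top hΨ hgt 0 hr,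
    memOrliczMorrey_of_morreyNorm_ne_top hΨ hgm.ennreal_toReal (hle.trans_lt hgt.lt_top).ne,
    hle.trans hg⟩

/-! ### Necessity -/

/-- For `r ≥ t` the weight decreases in `r`, so `r = t` is the worst case. For `r ≤ t` the cut-off
is at most the indicator of the small ball, giving `ρ(r)⁻¹ ≤ D * ρ(t)⁻¹`. -/
theorem morreyNorm_indicator_ball_le (hΦ : IsStarShaped Φ) {p : ℝ} (hp : 0 ≤ p) {D : ℝ≥0}
    (hD1 : 1 ≤ D)
    (hD : ∀ r s : ℝ, 0 < r → r ≤ s → ballRatio n Φ p s ≤ D * ballRatio n Φ p r)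
    {t : ℝ} (ht : 0 < t) :
    morreyNorm Φ p ((Metric.ball (0 : EuclideanSpace ℝ (Fin n)) t).indicator fun _ => 1) ≤
      D * (ballRatio n Φ p t)⁻¹ := by
  have hD0 : (D : ℝ≥0∞) ≠ 0 := by simpa using (zero_lt_one.trans_le hD1).ne'
  have hinv : ∀ r : ℝ, 0 < r → (ballRatio n Φ p r)⁻¹ = ballInv n Φ p r * (ballInv n Φ 1 r)⁻¹ :=
    fun r hr => by
      rw [ballRatio, ENNReal.inv_div (Or.inl (ballInv_ne_top hΦ p hr))
        (Or.inl (ballInv_ne_zero hΦ p hr)), div_eq_mul_inv]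
  refine iSup_le fun x => iSup₂_le fun r hr => ?_
  rcases le_total t r with htr | hrt
  · calc _ ≤ ballInv n Φ p t * (ballInv n Φ 1 t)⁻¹ := by
          gcongr
          · exact ballInv_anti hp htr
          · refine le_trans (luxNorm_mono (Eventually.of_forall fun y => ?_))
              (luxNorm_indicator_ball_le hΦ 0 ht)
            exact indicator_le_self _ _ _
      _ = 1 * (ballRatio n Φ p t)⁻¹ := by rw [hinv t ht, one_mul]
      _ ≤ _ := by gcongr; exact_mod_cast hD1
  · calc _ ≤ ballInv n Φ p r * (ballInv n Φ 1 r)⁻¹ := by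
          gcongr
          refine le_trans (luxNorm_mono (Eventually.of_forall fun y => ?_))
            (luxNorm_indicator_ball_le hΦ x hr)
          exact indicator_le_indicator (indicator_le_self _ _ _)
      _ = (ballRatio n Φ p r)⁻¹ := (hinv r hr).symm
      _ = D * (D * ballRatio n Φ p r)⁻¹ := by
          rw [ENNReal.mul_inv (Or.inl hD0) (Or.inl ENNReal.coe_ne_top), ← mul_assoc,
            ENNReal.mul_inv_cancel hD0 ENNReal.coe_ne_top, one_mul]
      _ ≤ _ := by
          gcongr
          exact hD r t hr hrt

/-- For `x` in the ball, the ball of radius `2 * t` about `x` contains it. -/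
theorem le_fracMaximal_indicator_ball {α : ℝ} (hα : 0 ≤ α) {t : ℝ} (ht : 0 < t)
    {x : EuclideanSpace ℝ (Fin n)} (hx : x ∈ Metric.ball (0 : EuclideanSpace ℝ (Fin n)) t) :
    (2 ^ n : ℝ≥0∞)⁻¹ * volume (Metric.ball (0 : EuclideanSpace ℝ (Fin n)) t) ^ (α / n) ≤
      fracMaximal α ((Metric.ball (0 : EuclideanSpace ℝ (Fin n)) t).indicator fun _ => 1) x := by
  have h2t : 0 < 2 * t := by positivity
  set V := volume (Metric.ball (0 : EuclideanSpace ℝ (Fin n)) t)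
  have hV0 : V ≠ 0 := volume_ball_ne_zero _ ht
  have hVt : V ≠ ∞ := volume_ball_ne_top _ _
  have h2n : (2 ^ n : ℝ≥0∞) ≠ 0 := by simp
  have hsub : Metric.ball (0 : EuclideanSpace ℝ (Fin n)) t ⊆ Metric.ball x (2 * t) := by
    refine Metric.ball_subset_ball' ?_
    rw [dist_comm]
    have : dist x 0 < t := hx
    linarith
  have hV2 : volume (Metric.ball x (2 * t)) = 2 ^ n * V := by
    rw [volume_ball_mul x 0 ht two_pos, ENNReal.ofReal_ofNat]
  refine le_trans ?_ (le_iSup₂_of_le (2 * t) h2t le_rfl)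
  calc (2 ^ n : ℝ≥0∞)⁻¹ * V ^ (α / n) = (2 ^ n : ℝ≥0∞)⁻¹ * V⁻¹ * V ^ (α / n) * V := by
        rw [mul_right_comm _ V⁻¹, mul_assoc _ V⁻¹, ENNReal.inv_mul_cancel hV0 hVt, mul_one]
    _ ≤ (2 ^ n : ℝ≥0∞)⁻¹ * V⁻¹ * (2 ^ n * V) ^ (α / n) * V := by
        gcongr
        exact le_mul_of_one_le_left' (one_le_pow₀ one_le_two)
    _ = volume (Metric.ball x (2 * t)) ^ (-1 + α / n) * V := by
        rw [hV2, ENNReal.rpow_add _ _ (mul_ne_zero h2n hV0) (ENNReal.mul_ne_top (by simp) hVt),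
          ENNReal.rpow_neg_one, ENNReal.mul_inv (Or.inl h2n) (Or.inl (by simp))]
    _ = volume (Metric.ball x (2 * t)) ^ (-1 + α / n) * ∫⁻ y in Metric.ball x (2 * t),
          ‖(Metric.ball (0 : EuclideanSpace ℝ (Fin n)) t).indicator (fun _ => (1 : ℝ)) y‖ₑ := by
        simp only [enorm_indicator_eq_indicator_enorm, enorm_one]
        rw [lintegral_indicator_const measurableSet_ball, one_mul,
          Measure.restrict_apply measurableSet_ball, inter_eq_left.2 hsub]

theorem exists_rpow_le_of_fracMaximalBounded (hn : n ≠ 0) (hΦ : IsStarShaped Φ)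
    {α β lam : ℝ} (hα : 0 ≤ α) (hβ : 0 < β) (hβ1 : β < 1) (hlam : 0 ≤ lam) {D : ℝ≥0}
    (hD1 : 1 ≤ D)
    (hD : ∀ r s : ℝ, 0 < r → r ≤ s →
      ballRatio n Φ (lam / n) s ≤ D * ballRatio n Φ (lam / n) r)
    (hM : FracMaximalBounded n α lam Φ fun t => Φ (t ^ (1 / β))) :
    ∃ C : ℝ≥0, ∀ t : ℝ≥0, 0 < t →
      (t : ℝ≥0∞) ^ α ≤ C * ballRatio n Φ (lam / n) t ^ (β - 1) := by
  have hn' : (n : ℝ) ≠ 0 := by exact_mod_cast hn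
  have hΨ := hΦ.comp_rpow (p := 1 / β) ((one_le_div hβ).2 hβ1.le)
  obtain ⟨C, hC⟩ := hM
  set b := volume (Metric.ball (0 : EuclideanSpace ℝ (Fin n)) 1)
  set e := (2 ^ n : ℝ≥0∞)⁻¹ * b ^ (α / n) with he
  have hbt : b ^ (α / n) ≠ ∞ := volume_rpow_ne_top _ one_pos _
  have he0 : e ≠ 0 := mul_ne_zero (by simp) (volume_rpow_ne_zero _ one_pos _)
  have het : e ≠ ∞ := ENNReal.mul_ne_top (by simp) hbt
  refine ⟨e.toNNReal⁻¹ * (C * D), fun t ht => ?_⟩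
  have ht' : (0 : ℝ) < t := ht
  set B := Metric.ball (0 : EuclideanSpace ℝ (Fin n)) t
  set f : EuclideanSpace ℝ (Fin n) → ℝ := B.indicator fun _ => 1
  set ρ := ballRatio n Φ (lam / n) t with hρ
  set W := ballInv n Φ (lam / n) t
  set U := ballInv n Φ 1 t
  have hρ0 : ρ ≠ 0 := ballRatio_ne_zero hΦ _ ht'
  have hρt : ρ ≠ ∞ := ballRatio_ne_top hΦ _ ht'
  have hW0 : W ≠ 0 := ballInv_ne_zero hΦ _ ht'
  have hWt : W ≠ ∞ := ballInv_ne_top hΦ _ ht'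
  have hfe : (fun x => ‖f x‖ₑ) = B.indicator fun _ => 1 := by
    ext x
    simp only [f, enorm_indicator_eq_indicator_enorm, enorm_one]
  have hK : morreyNorm Φ (lam / n) (fun x => ‖f x‖ₑ) ≤ D * ρ⁻¹ := by
    rw [hfe]
    exact morreyNorm_indicator_ball_le hΦ (by positivity) hD1 hD ht'
  have hKt : morreyNorm Φ (lam / n) (fun x => ‖f x‖ₑ) ≠ ∞ :=
    (hK.trans_lt (ENNReal.mul_lt_top ENNReal.coe_lt_top (ENNReal.inv_ne_top.2 hρ0).lt_top)).ne
  have hfm : Measurable f := measurable_const.indicator measurableSet_ball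
  obtain ⟨hfin, -, hle⟩ := hC f (memOrliczMorrey_of_morreyNorm_ne_top hΦ hfm hKt)
  rw [orliczMorreyNorm_eq_morreyNorm hΦ, orliczMorreyNorm_eq_morreyNorm hΨ] at hle
  set G : EuclideanSpace ℝ (Fin n) → ℝ≥0∞ := fun x => ‖(fracMaximal α f x).toReal‖ₑ
  have hvol : volume B ^ (α / n) = b ^ (α / n) * (t : ℝ≥0∞) ^ α := by
    rw [volume_ball_eq 0 ht', ENNReal.mul_rpow_of_ne_top (by simp) (volume_ball_ne_top _ _),
      ← ENNReal.rpow_natCast, ← ENNReal.rpow_mul, mul_div_cancel₀ _ hn', mul_comm,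
      ENNReal.ofReal_coe_nnreal]
  have hetα : e * (t : ℝ≥0∞) ^ α ≠ ∞ :=
    ENNReal.mul_ne_top het (ENNReal.rpow_ne_top_of_nonneg hα ENNReal.coe_ne_top)
  have hlow : e * (t : ℝ≥0∞) ^ α ≤ U ^ β * luxNorm (fun t => Φ (t ^ (1 / β))) (B.indicator G) := by
    rw [← ballInv_comp_rpow hβ, ballInv_one 0 ht', ← ENNReal.coe_toNNReal hetα]
    refine le_youngInv_mul_luxNorm hΨ measurableSet_ball (volume_ball_ne_zero _ ht')
      (volume_ball_ne_top _ _) (hfin.mono fun x hx hxB => ?_)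
    have hGx : G x = fracMaximal α f x := by
      simp only [G]
      rw [Real.enorm_eq_ofReal ENNReal.toReal_nonneg, ENNReal.ofReal_toReal hx.ne]
    rw [hGx, ENNReal.coe_toNNReal hetα, he, mul_assoc, ← hvol]
    exact le_fracMaximal_indicator_ball hα ht' hxB
  have hup : W ^ β * luxNorm (fun t => Φ (t ^ (1 / β))) (B.indicator G) ≤ C * (D * ρ⁻¹) := by
    rw [← ballInv_comp_rpow hβ]
    exact (ballInv_mul_luxNorm_le _ G 0 ht').trans (hle.trans (by gcongr))
  -- The lower bound carries `U ^ β` and the upper one `W ^ β`; their quotient `ρ ^ β` meets `ρ⁻¹`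
  -- to form `ρ ^ (β - 1)`.
  have hUW : U = ρ * W := (ENNReal.div_mul_cancel hW0 hWt).symm
  have hmain : e * (t : ℝ≥0∞) ^ α ≤ C * D * ρ ^ (β - 1) := by
    calc e * (t : ℝ≥0∞) ^ α
        ≤ U ^ β * luxNorm (fun t => Φ (t ^ (1 / β))) (B.indicator G) := hlow
      _ = ρ ^ β * (W ^ β * luxNorm (fun t => Φ (t ^ (1 / β))) (B.indicator G)) := by
          rw [hUW, ENNReal.mul_rpow_of_nonneg _ _ hβ.le, mul_assoc]
      _ ≤ ρ ^ β * (C * (D * ρ⁻¹)) := by gcongr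
      _ = C * D * ρ ^ (β - 1) := by
          rw [ENNReal.rpow_sub _ _ hρ0 hρt, ENNReal.rpow_one, div_eq_mul_inv]
          ring
  have hcoe : ((e.toNNReal⁻¹ : ℝ≥0) : ℝ≥0∞) = e⁻¹ := by
    rw [ENNReal.coe_inv (ENNReal.toNNReal_ne_zero.2 ⟨he0, het⟩), ENNReal.coe_toNNReal het]
  rw [ENNReal.coe_mul, hcoe, ENNReal.coe_mul]
  calc (t : ℝ≥0∞) ^ α = e⁻¹ * (e * (t : ℝ≥0∞) ^ α) := by
        rw [← mul_assoc, ENNReal.inv_mul_cancel he0 het, one_mul]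
    _ ≤ e⁻¹ * (C * D * ρ ^ (β - 1)) := by gcongr
    _ = _ := by ring

/-! ### Almost monotonicity of the ratio, and conclusion -/

theorem exists_ballRatio_le (hn : n ≠ 0) (hΦ : IsStarShaped Φ) {α lam : ℝ} (hα : 0 ≤ α)
    (hreg : ∃ C : ℝ≥0, 0 < C ∧ ∀ t : ℝ≥0, 0 < t →
      (⨆ (r : ℝ≥0) (_ : t < r), (r : ℝ≥0∞) ^ α * invRatio n lam Φ r) ≤
        C * ((t : ℝ≥0∞) ^ α * invRatio n lam Φ t)) :
    ∃ D : ℝ≥0, 1 ≤ D ∧ ∀ r s : ℝ, 0 < r → r ≤ s →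
      ballRatio n Φ (lam / n) s ≤ D * ballRatio n Φ (lam / n) r := by
  obtain ⟨C, -, hC⟩ := hreg
  obtain ⟨k, -, hk⟩ := exists_ballRatio_comparable hn hΦ lam
  refine ⟨max 1 (k * (C * k)), le_max_left _ _, fun r s hr hrs => ?_⟩
  -- The supremum in the hypothesis runs over strictly larger radii; equality is covered by `1 ≤ D`.
  rcases hrs.eq_or_lt with rfl | hlt
  · refine le_mul_of_one_le_left' ?_
    exact_mod_cast le_max_left _ _
  lift r to ℝ≥0 using hr.le
  lift s to ℝ≥0 using hr.le.trans hrs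
  have hr : 0 < r := hr
  have hlt : r < s := hlt
  have hs : 0 < s := hr.trans hlt
  have hs0 : (s : ℝ≥0∞) ^ α ≠ 0 :=
    (ENNReal.rpow_pos (ENNReal.coe_pos.2 hs) ENNReal.coe_ne_top).ne'
  have hst : (s : ℝ≥0∞) ^ α ≠ ∞ := ENNReal.rpow_ne_top_of_nonneg hα ENNReal.coe_ne_top
  have hinv : invRatio n lam Φ s ≤ C * invRatio n lam Φ r := by
    refine (ENNReal.mul_le_mul_iff_right hs0 hst).1 ?_
    calc (s : ℝ≥0∞) ^ α * invRatio n lam Φ s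
        ≤ ⨆ (q : ℝ≥0) (_ : r < q), (q : ℝ≥0∞) ^ α * invRatio n lam Φ q :=
          le_iSup₂_of_le s hlt le_rfl
      _ ≤ C * ((r : ℝ≥0∞) ^ α * invRatio n lam Φ r) := hC r hr
      _ ≤ C * ((s : ℝ≥0∞) ^ α * invRatio n lam Φ r) := by gcongr
      _ = (s : ℝ≥0∞) ^ α * (C * invRatio n lam Φ r) := mul_left_comm _ _ _
  calc ballRatio n Φ (lam / n) s ≤ k * invRatio n lam Φ s := (hk s hs).1
    _ ≤ k * (C * (k * ballRatio n Φ (lam / n) r)) := by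
        gcongr
        exact hinv.trans (by gcongr; exact (hk r hr).2)
    _ = (k * (C * k) : ℝ≥0) * ballRatio n Φ (lam / n) r := by push_cast; ring
    _ ≤ _ := by gcongr; exact le_max_right _ _

end OrliczMorrey

theorem mainTheorem5 (n : ℕ) (α lam β : ℝ) (hα : 0 < α) (hαn : α < n)
    (hlam : 0 ≤ lam) (hlamn : lam ≤ n) (hβ : 0 < β) (hβ1 : β < 1)
    (Φ Ψ : ℝ≥0 → ℝ≥0∞) (hΦ : OrliczMorrey.IsYoung Φ)
    (hΔ : OrliczMorrey.DeltaPrime Φ) (hN : OrliczMorrey.NablaTwo Φ)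
    (hΨ : ∀ t : ℝ≥0, Ψ t = Φ (t ^ (1 / β)))
    (hreg : ∃ C : ℝ≥0, 0 < C ∧ ∀ t : ℝ≥0, 0 < t →
      (⨆ (r : ℝ≥0) (_ : t < r), (r : ℝ≥0∞) ^ α * OrliczMorrey.invRatio n lam Φ r) ≤
        C * ((t : ℝ≥0∞) ^ α * OrliczMorrey.invRatio n lam Φ t)) :
    (∃ C : ℝ≥0, 0 < C ∧ ∀ t : ℝ≥0, 0 < t →
      (t : ℝ≥0∞) ^ α ≤ C * OrliczMorrey.invRatio n lam Φ t ^ (β - 1)) ↔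
    OrliczMorrey.FracMaximalBounded n α lam Φ Ψ := by
  obtain rfl : Ψ = fun t => Φ (t ^ (1 / β)) := funext hΨ
  have hS := hΦ.isStarShaped
  have hn : n ≠ 0 := by
    rintro rfl
    simp only [Nat.cast_zero] at hαn
    linarith
  obtain ⟨D, hD1, hD⟩ := OrliczMorrey.exists_ballRatio_le hn hS hα.le hreg
  obtain ⟨k, hk1, hk⟩ := OrliczMorrey.exists_ballRatio_comparable hn hS lam
  have hk0 : 0 < k := zero_lt_one.trans_le hk1
  have hk0' : (k : ℝ≥0∞) ≠ 0 := by simpa using hk0.ne'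
  have h1β : 0 ≤ 1 - β := sub_nonneg.2 hβ1.le
  constructor
  · rintro ⟨C, -, hC⟩
    refine OrliczMorrey.fracMaximalBounded_of_rpow_le hn hS hN hβ hβ1 hlam hlamn hD
      (C := C * k ^ (1 - β)) fun t ht => (hC t ht).trans ?_
    -- The exponent `β - 1` is negative, so an upper bound for one ratio bounds the power of the
    -- other.
    have := OrliczMorrey.rpow_neg_le_of_le_mul h1β hk0' ENNReal.coe_ne_top (hk t ht).1
    rw [neg_sub] at this
    rw [ENNReal.coe_mul, ENNReal.coe_rpow_of_nonneg _ h1β, mul_assoc]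
    gcongr
  · intro hM
    obtain ⟨C, hC⟩ := OrliczMorrey.exists_rpow_le_of_fracMaximalBounded hn hS hα.le hβ hβ1 hlam
      hD1 hD hM
    refine ⟨max 1 (C * k ^ (1 - β)), by positivity, fun t ht => (hC t ht).trans ?_⟩
    have := OrliczMorrey.rpow_neg_le_of_le_mul h1β hk0' ENNReal.coe_ne_top (hk t ht).2
    rw [neg_sub] at this
    calc _ ≤ C * (k ^ (1 - β) * OrliczMorrey.invRatio n lam Φ t ^ (β - 1)) := by gcongr
      _ = (C * k ^ (1 - β) : ℝ≥0) * OrliczMorrey.invRatio n lam Φ t ^ (β - 1) := by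
        rw [ENNReal.coe_mul, ENNReal.coe_rpow_of_nonneg _ h1β, mul_assoc]
      _ ≤ _ := by gcongr; exact le_max_right _ _
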